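/- Let $\mathbb A$ be a finite-dimensional real alternative algebra with unit $1$, equipped with a real-linear anti-involution $a\mapsto a^c$, i.e. $(a^c)^c=a$ and $(ab)^c=b^ca^c$. Let $(v_0,\dots,v_d)$ be a real basis of $\mathbb A$ and let $1\le m\le d$ be such that $v_0=1$, $v_s+v_s^c=0$ and $v_sv_s^c=1$ for $1\le s\le m$, and $v_sv_t=-v_tv_s$ for distinct $s,t\in\{1,\dots,m\}$; put $M=\operatorname{span}_{\mathbb R}(v_0,\dots,v_m)$. Let $n\ge 1$ and identify $x=(x_{j,s})\in\mathbb R^{(m+1)n}$ with $(x_1,\dots,x_n)\in M^n$, where $x_j=\sum_{s=0}^m x_{j,s}v_s$; $|x|$ is the Euclidean norm. For $\mathbb A$-valued functions $f=\sum_{t=0}^d f_tv_t$, continuity, differentiability and integrals are understood componentwise, and $$\overline\partial_jf=\sum_{s=0}^m v_s\,\frac{\partial f}{\partial x_{j,s}},\qquad 1\le j\le n .$$ A $C^1$ function $f$ on an open set $\Omega\subseteq M^n$ is called left monogenic in $\Omega$ if $\overline\partial_jf=0$ in $\Omega$ for all $j=1,\dots,n$. Let $\Omega\subset M^n$ be a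 bounded domain with piecewise smooth boundary $\Gamma=\partial\Omega$, that is: $\Gamma$ has finite surface area, and all of $\Gamma$ except for a set of zero surface area consists of points near which $\Gamma$ is a $C^1$ hypersurface with $\Omega$ on exactly one side. Let $\nu=(\nu_1,\dots,\nu_n)$ be the unit exterior normal at those points (with $\nu_j\in M$), $dS$ the surface measure (the $((m+1)n-1)$-dimensional Hausdorff measure, normalised to agree with Lebesgue measure on hyperplanes), $\Omega^-=M^n\setminus\overline\Omega$, $\sigma$ the area of the unit sphere of $\mathbb R^{(m+1)n}$, and $$K_j(x)=\frac1{\sigma}\,\frac{x_j^c}{|x|^{(m+1)n}},\qquad K(x,y)\ast f(y)=\sum_{j=1}^nK_j(y-x)\,\bigl(\nu_j(y)f(y)\bigr)\,dS(y).$$ If $f:\overline\Omega\to\mathbb A$ is left monogenic on $\overline\Omega$, in the sense that $f$ is continuous on $\overline\Omega$ and left monogenic in $\Omega$ (in particular if $f\in C^1(\overline\Omega,\mathbb A)$ is left monogenic in $\Omega$), then for every $x\in\Omega\cup\Omega^-$ the integrand is integrable over $\Gamma$, and $$\int_\Gamma K(x,y)\ast f(y)=\begin{cases}f(x),& x\in\Omega,\\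 0,& x\in\Omega^-.\end{cases}$$ -/

import Mathlib

open MeasureTheory Module Topology

noncomputable section

namespace BochnerMartinelli

/-! ### Real alternative `*`-algebras and hypercomplex bases -/

/-- The two alternative laws for a (not necessarily associative) multiplication. -/
class IsAlternative (A : Type*) [Mul A] : Prop where
  left_alternative : ∀ a b : A, (a * a) * b = a * (a * b)
  right_alternative : ∀ a b : A, (a * b) * b = a * (b * b)

section Algebra

variable {A : Type*} [NonAssocRing A] [StarRing A]

/-- The trace `t(x) = x + xᶜ`. The anti-involution `xᶜ` is written `star x`. -/
def trace (x : A) : A := x + star x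

/-- The (squared) norm `n(x) = x xᶜ`. -/
def sqNorm (x : A) : A := x * star x

variable (A) in
/-- The sphere of imaginary units compatible with the `*`-structure. -/
def imaginarySphere : Set A := {x | trace x = 0 ∧ sqNorm x = 1}

variable (A) [Module ℝ A] in
/-- An ordered real basis `(v₀, …, v_d)` of `A` whose first `m + 1` members `(v₀, …, v_m)` form a
hypercomplex basis (of their span, the hypercomplex subspace `M`). -/
structure HypercomplexBasis (m d : ℕ) where
  /-- the basis `(v₀, …, v_d)` of the whole algebra -/
  basis : Basis (Fin (d + 1)) ℝ A
  one_le : 1 ≤ m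
  le : m ≤ d
  apply_zero : basis 0 = 1
  mem_sphere : ∀ s : Fin (d + 1), 1 ≤ (s : ℕ) → (s : ℕ) ≤ m → basis s ∈ imaginarySphere A
  anticomm : ∀ s t : Fin (d + 1), 1 ≤ (s : ℕ) → (s : ℕ) ≤ m → 1 ≤ (t : ℕ) → (t : ℕ) ≤ m →
    s ≠ t → basis s * basis t = -(basis t * basis s)

end Algebra

/-- `Mⁿ`, identified with `ℝ^{(m+1)n}` (with its Euclidean norm) through the hypercomplex basis:
the coordinate `x (j, s)` is the coefficient of `v_s` in the `j`-th hypercomplex variable. -/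
abbrev Space (n m : ℕ) : Type := EuclideanSpace ℝ (Fin n × Fin (m + 1))

/-! ### Domains with piecewise smooth boundary -/

section Boundary

variable {n m : ℕ}

/-- The surface measure on `ℝ^{(m+1)n}`: the Hausdorff measure of dimension `(m+1)n - 1`, normalised
so as to agree with Lebesgue measure on hyperplanes. -/
def surfaceMeasure (n m : ℕ) : Measure (Space n m) := μHE[(m + 1) * n - 1]

/-- `ρ` is a local `C¹` defining function of `Ω` at the boundary point `p`. -/
structure IsDefiningFunctionAt (Ω : Set (Space n m)) (ρ : Space n m → ℝ) (p : Space n m) :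
    Prop where
  contDiffAt : ContDiffAt ℝ 1 ρ p
  apply_eq_zero : ρ p = 0
  gradient_ne_zero : gradient ρ p ≠ 0
  mem_iff : ∀ᶠ y in 𝓝 p, (y ∈ Ω ↔ ρ y < 0)

/-- `ν` is the unit exterior normal at `p` to the boundary of `Ω`: the boundary is a `C¹`
hypersurface near `p`, with `Ω` on exactly one side of it, and `ν` is orthogonal to it and points
to the other side. -/
def IsExteriorUnitNormal (Ω : Set (Space n m)) (p ν : Space n m) : Prop :=
  ∃ ρ : Space n m → ℝ, IsDefiningFunctionAt Ω ρ p ∧ ν = ‖gradient ρ p‖⁻¹ • gradient ρ p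

/-- The unit exterior normal is unique. -/
theorem IsExteriorUnitNormal.unique {Ω : Set (Space n m)} {p ν₁ ν₂ : Space n m}
    (h₁ : IsExteriorUnitNormal Ω p ν₁) (h₂ : IsExteriorUnitNormal Ω p ν₂) : ν₁ = ν₂ := by
  obtain ⟨ρ₁, d₁, rfl⟩ := h₁
  obtain ⟨ρ₂, d₂, rfl⟩ := h₂
  set g₁ := gradient ρ₁ p with hg₁
  set g₂ := gradient ρ₂ p with hg₂
  have n₁ : 0 < ‖g₁‖ := norm_pos_iff.2 d₁.gradient_ne_zero
  have n₂ : 0 < ‖g₂‖ := norm_pos_iff.2 d₂.gradient_ne_zero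
  set u₁ := ‖g₁‖⁻¹ • g₁ with hu₁
  set u₂ := ‖g₂‖⁻¹ • g₂ with hu₂
  have e₁ : ‖u₁‖ = 1 := by rw [hu₁, norm_smul, norm_inv, norm_norm, inv_mul_cancel₀ n₁.ne']
  have e₂ : ‖u₂‖ = 1 := by rw [hu₂, norm_smul, norm_inv, norm_norm, inv_mul_cancel₀ n₂.ne']
  by_contra hne
  have hlt : inner ℝ u₁ u₂ < 1 := (inner_lt_one_iff_real_of_norm_eq_one e₁ e₂).2 hne
  -- along the line through `p` in direction `w`, the sign of the derivative decides membership
  have line : ∀ ρ : Space n m → ℝ, IsDefiningFunctionAt Ω ρ p → ∀ w : Space n m,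
      HasDerivAt (fun t : ℝ => ρ (p + t • w)) (inner ℝ (gradient ρ p) w) 0 := by
    intro ρ hρ w
    have hG : HasGradientAt ρ (gradient ρ p) (p + (0 : ℝ) • w) := by
      simpa using (hρ.contDiffAt.differentiableAt (by simp)).hasGradientAt
    have hl : HasDerivAt (fun t : ℝ => p + t • w) w 0 := by
      simpa using ((hasDerivAt_id (0 : ℝ)).smul_const w).const_add p
    have := hG.hasFDerivAt.comp_hasDerivAt (0 : ℝ) hl
    rwa [InnerProductSpace.toDual_apply_apply] at this
  have tend : Filter.Tendsto (fun t : ℝ => p + t • (u₂ - u₁)) (𝓝[>] 0) (𝓝 p) := by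
    have : Continuous (fun t : ℝ => p + t • (u₂ - u₁)) := by fun_prop
    simpa using (this.tendsto 0).mono_left nhdsWithin_le_nhds
  have s₁ : inner ℝ g₁ (u₂ - u₁) < 0 := by
    have h : g₁ = ‖g₁‖ • u₁ := by rw [hu₁, smul_smul, mul_inv_cancel₀ n₁.ne', one_smul]
    rw [h, real_inner_smul_left, inner_sub_right, real_inner_self_eq_norm_sq, e₁]
    nlinarith
  have s₂ : 0 < inner ℝ g₂ (u₂ - u₁) := by
    have h : g₂ = ‖g₂‖ • u₂ := by rw [hu₂, smul_smul, mul_inv_cancel₀ n₂.ne', one_smul]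
    rw [h, real_inner_smul_left, inner_sub_right, real_inner_self_eq_norm_sq, e₂,
      real_inner_comm]
    nlinarith
  have neg : ∀ᶠ t : ℝ in 𝓝[>] 0, ρ₁ (p + t • (u₂ - u₁)) < 0 := by
    have h := (hasDerivAt_iff_tendsto_slope.1 (line ρ₁ d₁ (u₂ - u₁))).eventually
      (gt_mem_nhds s₁)
    filter_upwards [h.filter_mono (nhdsWithin_mono _ fun t ht => ne_of_gt ht),
      self_mem_nhdsWithin] with t ht htpos
    have htpos : (0 : ℝ) < t := htpos
    simp only [slope_def_field, zero_smul, add_zero, sub_zero, d₁.apply_eq_zero] at ht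
    exact (div_neg_iff.1 ht).elim (fun h => absurd h.2 (not_lt.2 htpos.le)) (fun h => h.1)
  have pos : ∀ᶠ t : ℝ in 𝓝[>] 0, 0 < ρ₂ (p + t • (u₂ - u₁)) := by
    have h := (hasDerivAt_iff_tendsto_slope.1 (line ρ₂ d₂ (u₂ - u₁))).eventually
      (lt_mem_nhds s₂)
    filter_upwards [h.filter_mono (nhdsWithin_mono _ fun t ht => ne_of_gt ht),
      self_mem_nhdsWithin] with t ht htpos
    have htpos : (0 : ℝ) < t := htpos
    simp only [slope_def_field, zero_smul, add_zero, sub_zero, d₂.apply_eq_zero] at ht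
    exact (div_pos_iff.1 ht).elim (fun h => h.1) (fun h => absurd h.2 (not_lt.2 htpos.le))
  obtain ⟨t, ht₁, ht₂, hm₁, hm₂⟩ :=
    (neg.and (pos.and ((tend.eventually d₁.mem_iff).and (tend.eventually d₂.mem_iff)))).exists
  exact absurd (hm₂.1 (hm₁.2 ht₁)) (not_lt.2 ht₂.le)

/-- A smooth boundary point: one that has a unit exterior normal in the sense above. -/
def IsSmoothBoundaryPoint (Ω : Set (Space n m)) (p : Space n m) : Prop :=
  ∃ ν, IsExteriorUnitNormal Ω p ν

open Classical in
/-- The unit exterior normal `ν(p)` to the boundary of `Ω` (zero at non-smooth points). -/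
def exteriorNormal (Ω : Set (Space n m)) (p : Space n m) : Space n m :=
  if h : IsSmoothBoundaryPoint Ω p then h.choose else 0

/-- The boundary of `Ω` is piecewise smooth: it has finite surface area, and up to a set of surface
measure zero (edges, corners, …) it is a `C¹` hypersurface with `Ω` on one side. A boundary which
is made of finitely many compact `C¹` pieces that meet only along their lower-dimensional edges,
`Ω` being on one side of each, is of this kind. -/
structure HasPiecewiseSmoothBoundary (Ω : Set (Space n m)) : Prop where
  area_lt_top : surfaceMeasure n m (frontier Ω) < ⊤
  singular_null : surfaceMeasure n m {p ∈ frontier Ω | ¬ IsSmoothBoundaryPoint Ω p} = 0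

/-- A bounded domain with piecewise smooth boundary. -/
structure IsPiecewiseSmoothDomain (Ω : Set (Space n m)) : Prop where
  isOpen : IsOpen Ω
  isConnected : IsConnected Ω
  isBounded : Bornology.IsBounded Ω
  boundary : HasPiecewiseSmoothBoundary Ω

end Boundary

/-! ### Monogenic functions, integrals and the Bochner-Martinelli kernel -/

section Kernel

variable {A : Type*} [NonAssocRing A] [StarRing A] [Module ℝ A] {m d n : ℕ}

namespace HypercomplexBasis

variable (B : HypercomplexBasis A m d)

/-- The member `v_s` of the hypercomplex basis, `s = 0, …, m`. -/
def v (s : Fin (m + 1)) : A := B.basis (Fin.castLE (Nat.succ_le_succ B.le) s)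

/-- The real component `f_t` of `f = ∑ f_t v_t`. -/
def component (f : Space n m → A) (t : Fin (d + 1)) (x : Space n m) : ℝ := B.basis.repr (f x) t

/-- The `j`-th hypercomplex variable `x_j = ∑ x_{j,s} v_s`. -/
def coord (x : Space n m) (j : Fin n) : A := ∑ s : Fin (m + 1), x (j, s) • B.v s

/-- The Dirac operator `∂̄_j f = ∑ v_s v_t ∂f_t/∂x_{j,s}`. -/
def dirac (j : Fin n) (f : Space n m → A) (x : Space n m) : A :=
  ∑ s : Fin (m + 1), ∑ t : Fin (d + 1),
    fderiv ℝ (B.component f t) x (EuclideanSpace.single (j, s) 1) • (B.v s * B.basis t)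

/-- `f` is left monogenic in the open set `Ω`. -/
structure LeftMonogenicOn (f : Space n m → A) (Ω : Set (Space n m)) : Prop where
  contDiffOn : ∀ t, ContDiffOn ℝ 1 (B.component f t) Ω
  dirac_eq_zero : ∀ x ∈ Ω, ∀ j, B.dirac j f x = 0

/-- `f` is left monogenic in `Ω` and continuous up to the boundary. -/
structure LeftMonogenicOnClosure (f : Space n m → A) (Ω : Set (Space n m)) : Prop where
  leftMonogenicOn : B.LeftMonogenicOn f Ω
  continuousOn : ∀ t, ContinuousOn (B.component f t) (closure Ω)

/-- All real components of `g` are integrable over the surface `Γ`. -/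
def SurfaceIntegrable (Γ : Set (Space n m)) (g : Space n m → A) : Prop :=
  ∀ t, IntegrableOn (B.component g t) Γ (surfaceMeasure n m)

/-- The integral `∫_Γ g dS = ∑ v_t ∫_Γ g_t dS`. -/
def surfaceIntegral (Γ : Set (Space n m)) (g : Space n m → A) : A :=
  ∑ t : Fin (d + 1), (∫ y in Γ, B.component g t y ∂(surfaceMeasure n m)) • B.basis t

/-- `K_j(x) = x_jᶜ / (σ |x|^{(m+1)n})`, where `σ` is the area of the unit sphere. -/
def kernel (j : Fin n) (x : Space n m) : A :=
  ((surfaceMeasure n m).real (Metric.sphere 0 1) * ‖x‖ ^ ((m + 1) * n))⁻¹ • star (B.coord x j)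

/-- The density `∑_j K_j(y - x) (ν_j(y) f(y))` of `K(x,y) ∗ f(y)` with respect to the surface
element `dS(y)` of the boundary of `Ω`. -/
def kernelStar (Ω : Set (Space n m)) (f : Space n m → A) (x y : Space n m) : A :=
  ∑ j : Fin n, B.kernel j (y - x) * (B.coord (exteriorNormal Ω y) j * f y)

end HypercomplexBasis

end Kernel

end BochnerMartinelli

end

/-!
The integrand is, component by component, the normal component `ν · X` of a real vector field `X`
on `ℝ^N`, `N = (m+1)n`, and the theorem is the divergence theorem for `X`.

Write `K_j(y) = ∑ W_{j,s'}(y) v_{s'}ᶜ / σ` with the real field `W(y) = y / |y|^N`. Then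
`X_{j,s}(y) = ∑ W_{j,s'}(y - x) f_τ(y) [v_{s'}ᶜ (v_s v_τ)]_t / σ`. In `div X` the terms with a
derivative of `f` cancel because `f` is monogenic. In the other terms the Jacobian of `W` is
symmetric, so only the symmetrisation of `v_{s'}ᶜ (v_s a)` in `s, s'` matters, and by the
linearised alternative law this is `δ_{ss'} a`, as in the associative case
(`HypercomplexBasis.star_v_mul_v_mul`). Hence `div X = f_t div W / σ`
(`HypercomplexBasis.divergence_kernelField`). Instead of excising a ball around the pole `x`, `W`
is cut off there by a radial factor (`cutoffKernel`). This keeps the Jacobian symmetric, and makes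
`div W` a nonnegative bump near the pole. The divergence theorem on the unit ball shows that its
integral is the area `σ` of the unit sphere, so that `div W / σ` is an approximate identity; no
value of `σ` is needed.

The divergence theorem has to be proved for a boundary which is a `C¹` hypersurface only up to a
closed set of zero Hausdorff measure, and for a field which is `C¹` only inside
(`integral_divergence_eq`). Near a smooth boundary point, a chart with derivative close to the
identity flattens the boundary (`exists_flatteningChart`). The field is cut off at height `t` below
the boundary, where the integral of a divergence over the whole space vanishes, and as `t → 0` the
layer integrals converge to an integral over a hyperplane (`tendsto_integral_layer`). No area
formula for the Hausdorff measure is used: the chart is bi-Lipschitz with constant close to `1`, so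
that it distorts the surface measure by a factor close to `1`. This gives the divergence theorem
for fields with small support up to an arbitrarily small multiple of `∫ |Y| dS`
(`exists_nhds_abs_integral_divergence_sub_le`). These errors add up under a partition of unity, and
the error disappears in the limit. Finally the singular set is removed by cutoffs with gradients
small in `L¹` (`exists_cutoff`), which exist because it has zero `(N-1)`-dimensional measure.
-/

noncomputable section

namespace BochnerMartinelli

open Set Filter

/-! ### Thin layers below a hyperplane -/

section Layer

variable {E : Type*} [NormedAddCommGroup E] [InnerProductSpace ℝ E] [FiniteDimensional ℝ E]
  [MeasurableSpace E] [BorelSpace E]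

/-- Cartesian coordinates `(s, z) ↦ p + s u + z` adapted to the hyperplane through `p` with unit
normal `u`. -/
def hyperplaneCoord (p u : E) (hu : ‖u‖ = 1) : ℝ × (ℝ ∙ u)ᗮ ≃ᵐ E :=
  ((LinearIsometryEquiv.toSpanUnitSingleton u hu).toHomeomorph.toMeasurableEquiv.prodCongr
    (MeasurableEquiv.refl _)).trans ((ℝ ∙ u).measurableEquivProd p).symm

lemma hyperplaneCoord_apply (p u : E) (hu : ‖u‖ = 1) (q : ℝ × (ℝ ∙ u)ᗮ) :
    hyperplaneCoord p u hu q = p + q.1 • u + q.2 := by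
  change (q.1 • u + (q.2 : E)) +ᵥ p = _
  rw [vadd_eq_add]
  abel

lemma measurePreserving_hyperplaneCoord (p u : E) (hu : ‖u‖ = 1) :
    MeasurePreserving (hyperplaneCoord p u hu) (volume.prod volume) volume := by
  have h1 := ((ℝ ∙ u).measurePreserving_measurableEquivProd p).symm
  rw [InnerProductSpace.euclideanHausdorffMeasure_eq_volume] at h1
  have h2 : MeasurePreserving ((LinearIsometryEquiv.toSpanUnitSingleton (𝕜 := ℝ) u
      hu).toHomeomorph.toMeasurableEquiv.prodCongr (MeasurableEquiv.refl (ℝ ∙ u)ᗮ))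
      (volume.prod volume) (volume.prod volume) :=
    (LinearIsometryEquiv.toSpanUnitSingleton (𝕜 := ℝ) u hu).measurePreserving.prod
      (MeasurePreserving.id volume)
  exact h2.trans h1

lemma inner_hyperplaneCoord (p u : E) (hu : ‖u‖ = 1) (q : ℝ × (ℝ ∙ u)ᗮ) :
    inner ℝ u (hyperplaneCoord p u hu q - p) = q.1 := by
  have h : inner ℝ u (q.2 : E) = 0 := Submodule.mem_orthogonal_singleton_iff_inner_right.1 q.2.2
  rw [hyperplaneCoord_apply, add_assoc, add_sub_cancel_left, inner_add_right, h,
    real_inner_smul_right, real_inner_self_eq_norm_sq, hu]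
  simp

lemma norm_le_norm_hyperplaneCoord (p u : E) (hu : ‖u‖ = 1) (q : ℝ × (ℝ ∙ u)ᗮ) :
    ‖q.2‖ ≤ ‖hyperplaneCoord p u hu q - p‖ := by
  have h : inner ℝ u (q.2 : E) = 0 := Submodule.mem_orthogonal_singleton_iff_inner_right.1 q.2.2
  rw [hyperplaneCoord_apply, add_assoc, add_sub_cancel_left]
  have := norm_add_sq_eq_norm_sq_add_norm_sq_real
    (x := q.1 • u) (y := (q.2 : E)) (by rw [real_inner_smul_left, h, mul_zero])
  change ‖(q.2 : E)‖ ≤ _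
  nlinarith [norm_nonneg (q.1 • u), norm_nonneg (q.2 : E), norm_nonneg (q.1 • u + (q.2 : E))]

/-- Averages over thinning layers below a hyperplane converge to the integral over the
hyperplane. -/
theorem tendsto_integral_layer (p u : E) (hu : ‖u‖ = 1) {w : ℝ → ℝ} (hwc : Continuous w)
    (hwi : Integrable w) {Cw : ℝ} (hwb : ∀ τ, ‖w τ‖ ≤ Cw) (hw0 : ∀ τ ≤ 0, w τ = 0)
    (hw1 : ∫ τ, w τ = 1) {k : E → ℝ} (hk : Measurable k) {C R : ℝ} (hkb : ∀ y, ‖k y‖ ≤ C)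
    (hkR : ∀ y, k y ≠ 0 → ‖y - p‖ ≤ R)
    (hlim : ∀ z : (ℝ ∙ u)ᗮ, Tendsto (fun s : ℝ => k (p + (-s) • u + z)) (𝓝[>] 0) (𝓝 (k (p + z)))) :
    Tendsto (fun t : ℝ => ∫ y, t⁻¹ * w (-(inner ℝ u (y - p)) / t) * k y) (𝓝[>] 0)
      (𝓝 (∫ z : (ℝ ∙ u)ᗮ, k (p + z))) := by
  have hC : 0 ≤ C := (norm_nonneg _).trans (hkb p)
  have hCw : 0 ≤ Cw := (norm_nonneg _).trans (hwb 0)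
  set e := hyperplaneCoord p u hu with he
  have hmp := measurePreserving_hyperplaneCoord p u hu
  -- substitution `s = -t τ` in the normal direction
  have key : ∀ t : ℝ, 0 < t → ∫ y, t⁻¹ * w (-(inner ℝ u (y - p)) / t) * k y =
      ∫ z : (ℝ ∙ u)ᗮ, ∫ τ, w τ * k (e (-t * τ, z)) := by
    intro t ht
    have hint : Integrable (fun y : E => t⁻¹ * w (-(inner ℝ u (y - p)) / t) * k y) := by
      have hb : IntegrableOn (fun _ : E => t⁻¹ * Cw * C) (Metric.closedBall p R) :=
        integrableOn_const (measure_closedBall_lt_top.ne)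
      refine Integrable.mono' (hb.integrable_indicator measurableSet_closedBall) ?_ ?_
      · apply Measurable.aestronglyMeasurable
        have : Measurable fun y : E => w (-(inner ℝ u (y - p)) / t) := by
          apply Continuous.measurable; fun_prop
        exact (this.const_mul _).mul hk
      · refine Eventually.of_forall fun y => ?_
        by_cases hy : k y = 0
        · rw [hy, mul_zero, norm_zero]
          exact indicator_nonneg (fun _ _ => by positivity) _
        · rw [indicator_of_mem (by simpa [dist_eq_norm] using hkR y hy), norm_mul, norm_mul,
            norm_inv, Real.norm_of_nonneg ht.le]
          gcongr
          exacts [hwb _, hkb _]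
    rw [← hmp.integral_comp e.measurableEmbedding]
    have hint2 := (hmp.integrable_comp_emb e.measurableEmbedding).2 hint
    refine (integral_prod_symm _ hint2).trans ?_
    refine integral_congr_ae (Eventually.of_forall fun z => ?_)
    have := Measure.integral_comp_mul_left (fun τ => w τ * k (e (-t * τ, z))) (-t⁻¹)
    simp only
    have h2 : |(-t⁻¹)⁻¹| = t := by rw [← neg_inv, abs_neg, inv_inv, abs_of_pos ht]
    rw [h2] at this
    calc ∫ s, t⁻¹ * w (-(inner ℝ u (hyperplaneCoord p u hu (s, z) - p)) / t) * k (e (s, z))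
        = ∫ s, t⁻¹ * (w (-t⁻¹ * s) * k (e (-t * (-t⁻¹ * s), z))) := by
          congr 1; ext s
          rw [inner_hyperplaneCoord]
          have e1 : -t * (-t⁻¹ * s) = s := by field_simp
          have e2 : -s / t = -t⁻¹ * s := by field_simp
          simp only [e1, e2]; ring
      _ = _ := by
          rw [integral_const_mul, this, smul_eq_mul, inv_mul_cancel_left₀ ht.ne']
  have hev : ∀ᶠ t : ℝ in 𝓝[>] 0, (∫ z : (ℝ ∙ u)ᗮ, ∫ τ, w τ * k (e (-t * τ, z))) =
      ∫ y, t⁻¹ * w (-(inner ℝ u (y - p)) / t) * k y := by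
    filter_upwards [self_mem_nhdsWithin] with t ht using (key t ht).symm
  refine Tendsto.congr' hev ?_
  have hem : Measurable e := e.measurable
  have hmeas : ∀ t : ℝ, Measurable fun q : (ℝ ∙ u)ᗮ × ℝ => w q.2 * k (e (-t * q.2, q.1)) := by
    intro t
    have h1 : Measurable fun q : (ℝ ∙ u)ᗮ × ℝ => e (-t * q.2, q.1) := by
      apply hem.comp; fun_prop
    exact ((hwc.measurable).comp measurable_snd).mul (hk.comp h1)
  refine tendsto_integral_filter_of_dominated_convergence
    ((Metric.closedBall (0 : (ℝ ∙ u)ᗮ) R).indicator fun _ => ∫ τ, ‖w τ‖ * C) ?_ ?_ ?_ ?_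
  · refine Eventually.of_forall fun t => ?_
    exact ((hmeas t).stronglyMeasurable.integral_prod_right).aestronglyMeasurable
  · refine Eventually.of_forall fun t => Eventually.of_forall fun z => ?_
    by_cases hz : ‖z‖ ≤ R
    · rw [indicator_of_mem (by simpa using hz)]
      refine norm_integral_le_of_norm_le (hwi.norm.mul_const C) (Eventually.of_forall fun τ => ?_)
      rw [norm_mul]
      gcongr
      exact hkb _
    · rw [indicator_of_notMem (by simpa using hz)]
      have : ∀ τ, k (e (-t * τ, z)) = 0 := fun τ => by
        by_contra h
        exact hz ((norm_le_norm_hyperplaneCoord p u hu (-t * τ, z)).trans (hkR _ h))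
      simp only [this, mul_zero, integral_zero, norm_zero, le_refl]
  · exact (integrableOn_const measure_closedBall_lt_top.ne).integrable_indicator
      measurableSet_closedBall
  · refine Eventually.of_forall fun z => ?_
    have : k (p + z) = ∫ τ, w τ * k (p + z) := by rw [integral_mul_const, hw1, one_mul]
    rw [this]
    refine tendsto_integral_filter_of_dominated_convergence (fun τ => ‖w τ‖ * C) ?_ ?_
      (hwi.norm.mul_const C) ?_
    · refine Eventually.of_forall fun t => ?_
      exact ((hmeas t).comp measurable_prodMk_left).aestronglyMeasurable
    · refine Eventually.of_forall fun t => Eventually.of_forall fun τ => ?_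
      rw [norm_mul]
      gcongr
      exact hkb _
    · refine Eventually.of_forall fun τ => ?_
      rcases le_or_gt τ 0 with h | h
      · simp [hw0 τ h]
      · refine Tendsto.const_mul _ ?_
        have ht : Tendsto (fun t : ℝ => t * τ) (𝓝[>] 0) (𝓝[>] 0) := by
          refine tendsto_nhdsWithin_iff.2 ⟨?_, ?_⟩
          · have : Continuous fun t : ℝ => t * τ := by fun_prop
            simpa using (this.tendsto 0).mono_left nhdsWithin_le_nhds
          · filter_upwards [self_mem_nhdsWithin] with t ht using mul_pos ht h
        refine ((hlim z).comp ht).congr fun t => ?_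
        simp [he, hyperplaneCoord_apply]

end Layer

/-! ### A smooth transition function -/

section Cutoff

/-- A smooth transition from `0` on `(-∞, 1]` to `1` on `[2, ∞)`. -/
def transition (s : ℝ) : ℝ := Real.smoothTransition (s - 1)

lemma contDiff_transition {k : ℕ∞} : ContDiff ℝ k transition :=
  Real.smoothTransition.contDiff.comp (contDiff_id.sub contDiff_const)

lemma transition_of_le {s : ℝ} (h : s ≤ 1) : transition s = 0 :=
  Real.smoothTransition.zero_of_nonpos (by linarith)

lemma transition_of_ge {s : ℝ} (h : 2 ≤ s) : transition s = 1 :=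
  Real.smoothTransition.one_of_one_le (by linarith)

lemma transition_nonneg (s : ℝ) : 0 ≤ transition s := Real.smoothTransition.nonneg _

lemma transition_le_one (s : ℝ) : transition s ≤ 1 := Real.smoothTransition.le_one _

lemma monotone_transition : Monotone transition := fun _ _ h =>
  Real.smoothTransition.monotone (by linarith)

lemma hasDerivAt_transition (s : ℝ) : HasDerivAt transition (deriv transition s) s :=
  ((contDiff_transition (k := 1)).differentiable (by simp) s).hasDerivAt

lemma continuous_deriv_transition : Continuous (deriv transition) :=
  (contDiff_transition (k := 1)).continuous_deriv (by simp)

lemma deriv_transition_nonneg (s : ℝ) : 0 ≤ deriv transition s := monotone_transition.deriv_nonneg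

lemma deriv_transition_of_lt {s : ℝ} (h : s < 1) : deriv transition s = 0 := by
  have : transition =ᶠ[𝓝 s] fun _ => 0 := by
    filter_upwards [Iio_mem_nhds h] with y hy using transition_of_le (le_of_lt hy)
  rw [this.deriv_eq, deriv_const]

lemma deriv_transition_of_gt {s : ℝ} (h : 2 < s) : deriv transition s = 0 := by
  have : transition =ᶠ[𝓝 s] fun _ => 1 := by
    filter_upwards [Ioi_mem_nhds h] with y hy using transition_of_ge (le_of_lt hy)
  rw [this.deriv_eq, deriv_const]

lemma hasCompactSupport_deriv_transition : HasCompactSupport (deriv transition) :=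
  HasCompactSupport.intro (isCompact_Icc (a := (1 : ℝ)) (b := 2)) fun s hs => by
    rcases lt_or_ge s 1 with h | h
    · exact deriv_transition_of_lt h
    · exact deriv_transition_of_gt (by by_contra h2; exact hs ⟨h, not_lt.1 h2⟩)

lemma integrable_deriv_transition : Integrable (deriv transition) :=
  continuous_deriv_transition.integrable_of_hasCompactSupport hasCompactSupport_deriv_transition

lemma integral_deriv_transition : ∫ s, deriv transition s = 1 := by
  have h0 : ∫ s, deriv transition s = ∫ s in (0 : ℝ)..3, deriv transition s := by
    rw [intervalIntegral.integral_of_le (by norm_num),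
        setIntegral_eq_integral_of_forall_compl_eq_zero]
    intro s hs
    rcases lt_or_ge s 1 with h | h
    · exact deriv_transition_of_lt h
    · refine deriv_transition_of_gt ?_
      by_contra h2
      exact hs ⟨by linarith, by linarith⟩
  rw [h0, intervalIntegral.integral_eq_sub_of_hasDerivAt (fun s _ => hasDerivAt_transition s)
    (continuous_deriv_transition.intervalIntegrable _ _), transition_of_ge (by norm_num),
    transition_of_le (by norm_num), sub_zero]

end Cutoff

/-! ### The divergence of a vector field -/

section Divergence

variable {n m : ℕ}

/-- The divergence `∑ ∂Y_i/∂x_i` of a vector field on `ℝ^{(m+1)n}`. -/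
def divergence (Y : Space n m → Space n m) (x : Space n m) : ℝ :=
  ∑ i, fderiv ℝ (fun y => Y y i) x (EuclideanSpace.single i 1)

lemma divergence_congr {Y Z : Space n m → Space n m} {x : Space n m} (h : Y =ᶠ[𝓝 x] Z) :
    divergence Y x = divergence Z x := by
  refine Finset.sum_congr rfl fun i _ => ?_
  have : (fun y => Y y i) =ᶠ[𝓝 x] fun y => Z y i := h.mono fun y hy => by simp only [hy]
  rw [this.fderiv_eq]

lemma divergence_zero_of_eventuallyEq {Y : Space n m → Space n m} {x : Space n m}
    (h : Y =ᶠ[𝓝 x] 0) : divergence Y x = 0 := by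
  rw [divergence_congr h]
  simp [divergence]

lemma sum_smul_single (v : Space n m) : ∑ i, v i • EuclideanSpace.single i (1 : ℝ) = v := by
  ext j
  simp [Finset.sum_apply, Pi.single_apply]

lemma divergence_smul {φ : Space n m → ℝ} {Y : Space n m → Space n m} {x : Space n m}
    (hφ : DifferentiableAt ℝ φ x) (hY : DifferentiableAt ℝ Y x) :
    divergence (fun y => φ y • Y y) x = φ x * divergence Y x + fderiv ℝ φ x (Y x) := by
  have hYi : ∀ i, DifferentiableAt ℝ (fun y => Y y i) x := fun i =>
    differentiableAt_euclidean.1 hY i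
  conv_rhs => rw [← sum_smul_single (Y x)]
  simp only [divergence, map_sum, Finset.mul_sum, ← Finset.sum_add_distrib, map_smul, smul_eq_mul]
  refine Finset.sum_congr rfl fun i _ => ?_
  have : (fun y => (φ y • Y y) i) = fun y => φ y * Y y i := by ext y; simp
  rw [this, fderiv_fun_mul hφ (hYi i)]
  simp

lemma continuousOn_divergence {Y : Space n m → Space n m} {U : Set (Space n m)} (hU : IsOpen U)
    (hY : ContDiffOn ℝ 1 Y U) : ContinuousOn (divergence Y) U := by
  refine continuousOn_finsetSum _ fun i _ => ?_
  have : ContDiffOn ℝ 1 (fun y => Y y i) U := contDiffOn_euclidean.1 hY i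
  exact (this.continuousOn_fderiv_of_isOpen hU le_rfl).clm_apply continuousOn_const

/-- The divergence of a compactly supported `C¹` vector field has integral zero. -/
lemma integral_divergence_eq_zero {Y : Space n m → Space n m} (hY : ContDiff ℝ 1 Y)
    (hc : HasCompactSupport Y) : ∫ x, divergence Y x = 0 := by
  have hYi : ∀ i, ContDiff ℝ 1 (fun y => Y y i) := fun i => contDiff_euclidean.1 hY i
  have hci : ∀ i, HasCompactSupport (fun y => Y y i) := fun i =>
    hc.comp_left (g := fun v : Space n m => v i) rfl
  have hint : ∀ i, Integrable fun x => fderiv ℝ (fun y => Y y i) x (EuclideanSpace.single i 1) := by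
    intro i
    exact (((hYi i).continuous_fderiv (by simp)).clm_apply continuous_const)
      |>.integrable_of_hasCompactSupport ((hci i).fderiv_apply ℝ _)
  unfold divergence
  rw [integral_finsetSum _ fun i _ => hint i]
  refine Finset.sum_eq_zero fun i _ => ?_
  have := integral_smul_fderiv_eq_neg_fderiv_smul_of_integrable (𝕜 := ℝ) (μ := volume)
    (f := fun _ : Space n m => (1 : ℝ)) (g := fun y => Y y i) (v := EuclideanSpace.single i 1)
    (by simp) (by simpa using hint i)
    (by simpa using (hYi i).continuous.integrable_of_hasCompactSupport (hci i))
    (fun x _ => differentiableAt_const _) (fun x _ => (hYi i).differentiable (by simp) x)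
  simpa using this

end Divergence

/-! ### Integrals against nearly equal measures -/

section Comparison

variable {α : Type*} [MeasurableSpace α]

lemma integral_sub_le_of_measure_le {μ ν : Measure α} {c : NNReal} (hμν : μ ≤ c • ν)
    {g : α → ℝ} (hg : Integrable g ν) (hg0 : 0 ≤ g) :
    ∫ x, g x ∂μ ≤ c * ∫ x, g x ∂ν := by
  have : ∫ x, g x ∂μ ≤ ∫ x, g x ∂(c • ν) :=
    integral_mono_measure hμν (Eventually.of_forall hg0) (hg.smul_measure_nnreal)
  rwa [integral_smul_nnreal_measure] at this

/-- Integrals against two nearly equal measures are nearly equal. -/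
lemma abs_integral_sub_integral_le {μ ν : Measure α} {c : NNReal} (hμν : μ ≤ c • ν)
    (hνμ : ν ≤ c • μ) (hc : 1 ≤ c) {g : α → ℝ} (hg : Integrable g ν) :
    |∫ x, g x ∂μ - ∫ x, g x ∂ν| ≤ (c * c - 1) * ∫ x, |g x| ∂ν := by
  have hgμ : Integrable g μ := (hg.smul_measure_nnreal (c := c)).mono_measure hμν
  have hc' : (1 : ℝ) ≤ c := by exact_mod_cast hc
  -- the estimate for nonnegative functions
  have key : ∀ h : α → ℝ, 0 ≤ h → Integrable h ν → Integrable h μ →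
      |∫ x, h x ∂μ - ∫ x, h x ∂ν| ≤ (c * c - 1) * ∫ x, h x ∂ν := by
    intro h h0 hν hμ
    have e1 := integral_sub_le_of_measure_le hμν hν h0
    have e2 := integral_sub_le_of_measure_le hνμ hμ h0
    have e3 : 0 ≤ ∫ x, h x ∂ν := integral_nonneg h0
    have e4 : 0 ≤ ∫ x, h x ∂μ := integral_nonneg h0
    rw [abs_le]
    constructor
    · nlinarith [mul_nonneg (sub_nonneg.2 hc') e3, mul_nonneg (sub_nonneg.2 hc') e4]
    · nlinarith [mul_nonneg (sub_nonneg.2 hc') e3]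
  have k1 := key (fun x => max (g x) 0) (fun x => le_max_right _ _) hg.pos_part hgμ.pos_part
  have k2 := key (fun x => max (-g x) 0) (fun x => le_max_right _ _) hg.neg_part hgμ.neg_part
  have s1 : ∀ x, g x = max (g x) 0 - max (-g x) 0 := fun x => by
    rcases le_total (g x) 0 with h | h
    · rw [max_eq_right h, max_eq_left (by linarith)]; ring
    · rw [max_eq_left h, max_eq_right (by linarith)]; ring
  have s2 : ∀ x, |g x| = max (g x) 0 + max (-g x) 0 := fun x => by
    rcases le_total (g x) 0 with h | h
    · rw [max_eq_right h, max_eq_left (by linarith), abs_of_nonpos h]; ring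
    · rw [max_eq_left h, max_eq_right (by linarith), abs_of_nonneg h]; ring
  have i1 : ∫ x, g x ∂μ = ∫ x, max (g x) 0 ∂μ - ∫ x, max (-g x) 0 ∂μ := by
    rw [← integral_sub hgμ.pos_part hgμ.neg_part]
    exact integral_congr_ae (Eventually.of_forall s1)
  have i2 : ∫ x, g x ∂ν = ∫ x, max (g x) 0 ∂ν - ∫ x, max (-g x) 0 ∂ν := by
    rw [← integral_sub hg.pos_part hg.neg_part]
    exact integral_congr_ae (Eventually.of_forall s1)
  have i3 : ∫ x, |g x| ∂ν = ∫ x, max (g x) 0 ∂ν + ∫ x, max (-g x) 0 ∂ν := by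
    rw [← integral_add hg.pos_part hg.neg_part]
    exact integral_congr_ae (Eventually.of_forall s2)
  rw [i1, i2, i3]
  rw [abs_le] at *
  constructor <;> linarith [k1.1, k1.2, k2.1, k2.2]

end Comparison

/-! ### Charts flattening the boundary -/

section Chart

variable {n m : ℕ}

/-- A `C¹` chart `Φ` around the boundary point `p` of `Ω` which flattens the boundary: the part of
`Ω` in the chart domain is mapped below the hyperplane through `p` with unit normal `u`. The chart
is a `K`-bi-Lipschitz map, and its Jacobian determinant differs from the length of the gradient of
the height function `σ` at most by the factor `1 ± ε`. -/
structure FlatteningChart (Ω : Set (Space n m)) (p : Space n m) (K : NNReal) (ε : ℝ) where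
  /-- the unit normal of the target hyperplane -/
  u : Space n m
  /-- the height over the target hyperplane, a local defining function of `Ω` -/
  σ : Space n m → ℝ
  /-- the chart itself -/
  Φ : OpenPartialHomeomorph (Space n m) (Space n m)
  /-- the derivative of the chart -/
  Φ' : Space n m → Space n m →L[ℝ] Space n m
  norm_u : ‖u‖ = 1
  mem_source : p ∈ Φ.source
  source_subset : Φ.source ⊆ Metric.ball p 1
  contDiffOn : ContDiffOn ℝ 1 σ Φ.source
  inner_eq : ∀ y ∈ Φ.source, inner ℝ u (Φ y - p) = σ y
  mem_iff : ∀ y ∈ Φ.source, (y ∈ Ω ↔ σ y < 0)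
  hasFDerivAt : ∀ y ∈ Φ.source, HasFDerivAt Φ (Φ' y) y
  continuousOn_det : ContinuousOn (fun y => (Φ' y).det) Φ.source
  half_le_det : ∀ y ∈ Φ.source, 1 / 2 ≤ |(Φ' y).det|
  fderiv_ne_zero : ∀ y ∈ Φ.source, fderiv ℝ σ y ≠ 0
  ratio : ∀ y ∈ Φ.source, |‖fderiv ℝ σ y‖ / |(Φ' y).det| - 1| ≤ ε
  lipschitz : LipschitzOnWith K Φ Φ.source
  lipschitz_symm : LipschitzOnWith K Φ.symm Φ.target

lemma norm_gradient {ρ : Space n m → ℝ} {y : Space n m} : ‖gradient ρ y‖ = ‖fderiv ℝ ρ y‖ := by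
  simp [gradient]

lemma inner_gradient {ρ : Space n m → ℝ} {y v : Space n m} :
    inner ℝ (gradient ρ y) v = fderiv ℝ ρ y v := by
  simp [gradient]

theorem exists_flatteningChart {Ω : Set (Space n m)} {p : Space n m} {ρ : Space n m → ℝ}
    (hρ : IsDefiningFunctionAt Ω ρ p) {K : NNReal} (hK : 1 < K) {ε : ℝ} (hε : 0 < ε) :
    Nonempty (FlatteningChart Ω p K ε) := by
  set c : ℝ := ‖gradient ρ p‖⁻¹ with hc
  have hg : 0 < ‖gradient ρ p‖ := norm_pos_iff.2 hρ.gradient_ne_zero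
  have hc0 : 0 < c := inv_pos.2 hg
  set u : Space n m := c • gradient ρ p with hu
  have hu1 : ‖u‖ = 1 := by
    rw [hu, norm_smul, Real.norm_of_nonneg hc0.le, hc, inv_mul_cancel₀ hg.ne']
  set σ : Space n m → ℝ := fun y => c * ρ y with hσ
  have hσd : ContDiffAt ℝ 1 σ p := contDiffAt_const.mul hρ.contDiffAt
  have hfp : fderiv ℝ σ p = innerSL ℝ u := by
    ext v
    rw [innerSL_apply_apply, hu, real_inner_smul_left, inner_gradient, hσ,
      fderiv_const_mul (hρ.contDiffAt.differentiableAt (by simp))]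
    simp
  set Φ : Space n m → Space n m := fun y => y + (σ y - inner ℝ u (y - p)) • u with hΦ
  set Φ' : Space n m → Space n m →L[ℝ] Space n m := fun y =>
    ContinuousLinearMap.id ℝ _ + (fderiv ℝ σ y - innerSL ℝ u).smulRight u with hΦ'
  have hΦd : ∀ y, DifferentiableAt ℝ σ y → HasFDerivAt Φ (Φ' y) y := by
    intro y hy
    have h1 : HasFDerivAt (fun y => inner ℝ u (y - p)) (innerSL ℝ u) y :=
      (innerSL ℝ u).hasFDerivAt.comp y ((hasFDerivAt_id y).sub_const p)
    exact (hasFDerivAt_id y).add ((hy.hasFDerivAt.sub h1).smul_const u)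
  have hΦp : Φ' p = ContinuousLinearMap.id ℝ _ := by
    simp only [hΦ', hfp, sub_self]
    ext v; simp
  have hσev : ∀ᶠ y in 𝓝 p, ContDiffAt ℝ 1 σ y := hσd.eventually (by simp)
  have hΦc : ContDiffAt ℝ 1 Φ p := by
    refine contDiffAt_id.add ((hσd.sub ?_).smul contDiffAt_const)
    exact (contDiffAt_const.inner ℝ (contDiffAt_id.sub contDiffAt_const))
  have hstrict : HasStrictFDerivAt Φ
      ((ContinuousLinearEquiv.refl ℝ (Space n m) : Space n m →L[ℝ] Space n m)) p := by
    have := hΦc.hasStrictFDerivAt' (hΦd p (hσd.differentiableAt (by simp))) (by simp)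
    rw [hΦp] at this
    exact this
  set δ : NNReal := 1 - K⁻¹ with hδ
  have hK0 : 0 < K := zero_lt_one.trans hK
  have hKi : K⁻¹ < 1 := inv_lt_one_of_one_lt₀ hK
  have hδ0 : 0 < δ := tsub_pos_of_lt hKi
  have hδr : (δ : ℝ) = 1 - (K : ℝ)⁻¹ := by rw [hδ, NNReal.coe_sub hKi.le]; simp
  have hδ1 : δ < 1 := tsub_lt_self one_pos (inv_pos.2 hK0)
  obtain ⟨s, hs, hsA⟩ := hstrict.approximates_deriv_on_nhds (Or.inr hδ0)
  have hcdσ : ContinuousAt (fderiv ℝ σ) p := hσd.continuousAt_fderiv (by simp)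
  have hdetc : Continuous fun L : Space n m →L[ℝ] ℝ =>
      (ContinuousLinearMap.id ℝ _ + (L - innerSL ℝ u).smulRight u :
          Space n m →L[ℝ] Space n m).det := by
    apply ContinuousLinearMap.continuous_det.comp
    have : Continuous fun L : Space n m →L[ℝ] ℝ => L.smulRight u :=
      (ContinuousLinearMap.smulRightL ℝ (Space n m) (Space n m)).flip u |>.continuous
    exact continuous_const.add (this.comp (continuous_id.sub continuous_const))
  have hdetp : ContinuousAt (fun y => (Φ' y).det) p :=
    ContinuousAt.comp (f := fderiv ℝ σ) hdetc.continuousAt hcdσ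
  have hdet1 : (Φ' p).det = 1 := by rw [hΦp]; simp [ContinuousLinearMap.det]
  have ev1 : ∀ᶠ y in 𝓝 p, 1 / 2 < |(Φ' y).det| :=
    (hdetp.abs).eventually (lt_mem_nhds (by simp only [hdet1]; norm_num))
  have hnp : ‖fderiv ℝ σ p‖ = 1 := by rw [hfp, innerSL_apply_norm, hu1]
  have ev2 : ∀ᶠ y in 𝓝 p, 1 / 2 < ‖fderiv ℝ σ y‖ :=
    (hcdσ.norm).eventually (lt_mem_nhds (by simp only [hnp]; norm_num))
  have ev3 : ∀ᶠ y in 𝓝 p, |‖fderiv ℝ σ y‖ / |(Φ' y).det| - 1| < ε := by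
    have : ContinuousAt (fun y => |‖fderiv ℝ σ y‖ / |(Φ' y).det| - 1|) p :=
      ((hcdσ.norm.div hdetp.abs (by simp [hdet1])).sub continuousAt_const).abs
    exact this.eventually (gt_mem_nhds (by simp [hdet1, hnp, hε]))
  have ev0 : ∀ᶠ y in 𝓝 p, y ∈ s := hs
  have ev4 : ∀ᶠ y in 𝓝 p, y ∈ Metric.ball p 1 := Metric.ball_mem_nhds p one_pos
  obtain ⟨V, hV, hVo, hpV⟩ := eventually_nhds_iff.1
    (ev0.and (hσev.and (hρ.mem_iff.and (ev1.and (ev2.and (ev3.and ev4))))))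
  have hA : ApproximatesLinearOn Φ
      ((ContinuousLinearEquiv.refl ℝ (Space n m) : Space n m →L[ℝ] Space n m)) V δ :=
    hsA.mono_set fun y hy => (hV y hy).1
  have hnt : Nontrivial (Space n m) := ⟨u, 0, fun h => by simp [h] at hu1⟩
  let e := hA.toOpenPartialHomeomorph Φ V (Or.inr (by
    have : ‖((ContinuousLinearEquiv.refl ℝ (Space n m)).symm :
        Space n m →L[ℝ] Space n m)‖₊ = 1 := by
      ext; exact ContinuousLinearMap.norm_id
    rw [this]; simpa using hδ1)) hVo
  have hes : e.source = V := rfl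
  have hef : ∀ y, e y = Φ y := fun y => rfl
  have hcV : ContDiffOn ℝ 1 σ V := fun y hy => (hV y hy).2.1.contDiffWithinAt
  have happ : ∀ x ∈ V, ∀ y ∈ V, ‖Φ x - Φ y - (x - y)‖ ≤ (1 - (K : ℝ)⁻¹) * ‖x - y‖ := by
    intro x hx y hy
    rw [← hδr]; exact hA x hx y hy
  have hKr : (1 : ℝ) < K := by exact_mod_cast hK
  have hlow : ∀ x ∈ V, ∀ y ∈ V, ‖x - y‖ ≤ K * ‖Φ x - Φ y‖ := by
    intro x hx y hy
    have h1 := happ x hx y hy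
    have h2 : ‖x - y‖ ≤ ‖Φ x - Φ y‖ + ‖Φ x - Φ y - (x - y)‖ := by
      have := norm_sub_le (Φ x - Φ y) (Φ x - Φ y - (x - y))
      rwa [sub_sub_cancel] at this
    have h3 : (K : ℝ)⁻¹ * ‖x - y‖ ≤ ‖Φ x - Φ y‖ := by linarith
    rwa [inv_mul_le_iff₀ (by linarith)] at h3
  refine ⟨⟨u, σ, e, Φ', hu1, hpV, fun y hy => (hV y hy).2.2.2.2.2.2, hcV,
      ?_, ?_, ?_, ?_, ?_, ?_, ?_,
    ?_, ?_⟩⟩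
  · intro y _
    rw [hef, hΦ]
    simp only
    rw [add_sub_right_comm, inner_add_right, real_inner_smul_right, real_inner_self_eq_norm_sq, hu1]
    ring
  · intro y hy
    rw [(hV y hy).2.2.1, hσ]
    simp only
    constructor
    · exact fun h => mul_neg_of_pos_of_neg hc0 h
    · exact fun h => (pos_iff_neg_of_mul_neg h).1 hc0
  · exact fun y hy => hΦd y ((hV y hy).2.1.differentiableAt (by simp))
  · exact hdetc.comp_continuousOn (hcV.continuousOn_fderiv_of_isOpen hVo le_rfl)
  · exact fun y hy => (hV y hy).2.2.2.1.le
  · intro y hy h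
    have := (hV y hy).2.2.2.2.1
    rw [h, norm_zero] at this
    linarith
  · exact fun y hy => (hV y hy).2.2.2.2.2.1.le
  · refine LipschitzOnWith.of_dist_le_mul fun x hx y hy => ?_
    rw [dist_eq_norm, dist_eq_norm]
    change ‖Φ x - Φ y‖ ≤ _
    have h1 := happ x hx y hy
    have h2 : ‖Φ x - Φ y‖ ≤ ‖Φ x - Φ y - (x - y)‖ + ‖x - y‖ := by
      have := norm_add_le (Φ x - Φ y - (x - y)) (x - y)
      rwa [sub_add_cancel] at this
    have h3 : 2 - (K : ℝ)⁻¹ ≤ K := by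
      have : (K : ℝ) * (K : ℝ)⁻¹ = 1 := mul_inv_cancel₀ (by linarith)
      have h4 : (0 : ℝ) < (K : ℝ)⁻¹ := by positivity
      nlinarith [mul_nonneg (sq_nonneg ((K : ℝ) - 1)) h4.le]
    nlinarith [norm_nonneg (x - y), mul_le_mul_of_nonneg_right h3 (norm_nonneg (x - y))]
  · refine LipschitzOnWith.of_dist_le_mul fun x hx y hy => ?_
    rw [dist_eq_norm, dist_eq_norm]
    have := hlow _ (e.map_target hx) _ (e.map_target hy)
    rwa [← hef, ← hef, e.right_inv hx, e.right_inv hy] at this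

namespace FlatteningChart

variable {Ω : Set (Space n m)} {p : Space n m} {K : NNReal} {ε : ℝ} (c : FlatteningChart Ω p K ε)
include c

lemma differentiableAt {y : Space n m} (hy : y ∈ c.Φ.source) : DifferentiableAt ℝ c.σ y :=
  (c.contDiffOn.contDiffAt (c.Φ.open_source.mem_nhds hy)).differentiableAt (by simp)

lemma det_pos {y : Space n m} (hy : y ∈ c.Φ.source) : 0 < |(c.Φ' y).det| :=
  lt_of_lt_of_le (by norm_num) (c.half_le_det y hy)

/-- Straight below a point at height `0`, the chart meets `Ω`. -/
lemma eventually_below {z : Space n m} (hz : z ∈ c.Φ.target) (hz0 : inner ℝ c.u (z - p) ≤ 0) :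
    ∀ᶠ s : ℝ in 𝓝[>] 0, z + (-s) • c.u ∈ c.Φ.target ∧ c.Φ.symm (z + (-s) • c.u) ∈ Ω := by
  have ht : Tendsto (fun s : ℝ => z + (-s) • c.u) (𝓝[>] 0) (𝓝 z) := by
    have : Continuous fun s : ℝ => z + (-s) • c.u := by fun_prop
    simpa using (this.tendsto 0).mono_left nhdsWithin_le_nhds
  filter_upwards [ht.eventually (c.Φ.open_target.mem_nhds hz), self_mem_nhdsWithin] with s hs hs0
  refine ⟨hs, ?_⟩
  have hs0 : (0 : ℝ) < s := hs0
  have h1 := c.Φ.map_target hs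
  rw [c.mem_iff _ h1, ← c.inner_eq _ h1, c.Φ.right_inv hs, add_sub_right_comm, inner_add_right,
    real_inner_smul_right, real_inner_self_eq_norm_sq, c.norm_u]
  linarith

lemma mem_closure_iff {y : Space n m} (hy : y ∈ c.Φ.source) : y ∈ closure Ω ↔ c.σ y ≤ 0 := by
  constructor
  · intro h
    by_contra hpos
    have hca : ContinuousAt c.σ y := (c.differentiableAt hy).continuousAt
    have : ∀ᶠ x in 𝓝 y, x ∉ Ω := by
      filter_upwards [hca.eventually (lt_mem_nhds (not_le.1 hpos)),
        c.Φ.open_source.mem_nhds hy] with x hx hxs hxΩ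
      exact absurd ((c.mem_iff x hxs).1 hxΩ) (not_lt.2 hx.le)
    obtain ⟨x, hx1, hx2⟩ := (mem_closure_iff_frequently.1 h |>.and_eventually this).exists
    exact hx2 hx1
  · intro h
    have hz := c.Φ.map_source hy
    have hb := c.eventually_below hz (by rw [c.inner_eq y hy]; exact h)
    have ht : Tendsto (fun s : ℝ => c.Φ.symm (c.Φ y + (-s) • c.u)) (𝓝[>] 0) (𝓝 y) := by
      have h1 : Tendsto (fun s : ℝ => c.Φ y + (-s) • c.u) (𝓝[>] 0) (𝓝 (c.Φ y)) := by
        have : Continuous fun s : ℝ => c.Φ y + (-s) • c.u := by fun_prop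
        simpa using (this.tendsto 0).mono_left nhdsWithin_le_nhds
      have h2 := (c.Φ.continuousAt_symm hz).tendsto
      rw [c.Φ.left_inv hy] at h2
      exact h2.comp h1
    exact mem_closure_of_tendsto ht (hb.mono fun s hs => hs.2)

lemma mem_frontier_iff (hΩ : IsOpen Ω) {y : Space n m} (hy : y ∈ c.Φ.source) :
    y ∈ frontier Ω ↔ c.σ y = 0 := by
  rw [hΩ.frontier_eq, Set.mem_sdiff, c.mem_closure_iff hy, c.mem_iff y hy, not_lt]
  exact ⟨fun h => le_antisymm h.1 h.2, fun h => ⟨h.le, h.ge⟩⟩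

lemma isDefiningFunctionAt (hΩ : IsOpen Ω) {y : Space n m} (hy : y ∈ c.Φ.source)
    (hyf : y ∈ frontier Ω) : IsDefiningFunctionAt Ω c.σ y where
  contDiffAt := c.contDiffOn.contDiffAt (c.Φ.open_source.mem_nhds hy)
  apply_eq_zero := (c.mem_frontier_iff hΩ hy).1 hyf
  gradient_ne_zero := by
    rw [← norm_pos_iff, norm_gradient, norm_pos_iff]
    exact c.fderiv_ne_zero y hy
  mem_iff := by
    filter_upwards [c.Φ.open_source.mem_nhds hy] with x hx using c.mem_iff x hx

lemma exteriorNormal_eq (hΩ : IsOpen Ω) {y : Space n m} (hy : y ∈ c.Φ.source)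
    (hyf : y ∈ frontier Ω) :
    exteriorNormal Ω y = ‖fderiv ℝ c.σ y‖⁻¹ • gradient c.σ y := by
  have h : IsExteriorUnitNormal Ω y (‖gradient c.σ y‖⁻¹ • gradient c.σ y) :=
    ⟨c.σ, c.isDefiningFunctionAt hΩ hy hyf, rfl⟩
  rw [norm_gradient] at h
  have h' : IsSmoothBoundaryPoint Ω y := ⟨_, h⟩
  rw [exteriorNormal, dif_pos h']
  exact h'.choose_spec.unique h

end FlatteningChart

lemma exteriorNormal_spec {Ω : Set (Space n m)} {p : Space n m} (h : IsSmoothBoundaryPoint Ω p) :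
    IsExteriorUnitNormal Ω p (exteriorNormal Ω p) := by
  rw [exteriorNormal, dif_pos h]
  exact h.choose_spec

lemma norm_exteriorNormal_le (Ω : Set (Space n m)) (p : Space n m) : ‖exteriorNormal Ω p‖ ≤ 1 := by
  by_cases h : IsSmoothBoundaryPoint Ω p
  · obtain ⟨ρ, hρ, h2⟩ := exteriorNormal_spec h
    rw [h2, norm_smul, norm_inv, norm_norm,
      inv_mul_cancel₀ (norm_pos_iff.2 hρ.gradient_ne_zero).ne']
  · rw [exteriorNormal, dif_neg h]
    simp

end Chart

/-! ### Surface measure in a chart -/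

section ChartMeasure

variable {n m : ℕ}

lemma euclideanHausdorffMeasure_image_le {X Y : Type*} [MetricSpace X] [MeasurableSpace X]
    [BorelSpace X] [MetricSpace Y] [MeasurableSpace Y] [BorelSpace Y] {K : NNReal} {f : X → Y}
    {s : Set X} (h : LipschitzOnWith K f s) (d : ℕ) :
    (μHE[d] : Measure Y) (f '' s) ≤ (K ^ d : NNReal) * (μHE[d] : Measure X) s := by
  have := h.hausdorffMeasure_image_le (d := (d : ℝ)) (by positivity)
  simp only [Measure.euclideanHausdorffMeasure_def, Measure.smul_apply, ENNReal.smul_def,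
      smul_eq_mul]
  rw [mul_left_comm]
  gcongr
  simpa using this

lemma finrank_orthogonal_of_norm_eq_one {u : Space n m} (hu : ‖u‖ = 1) :
    finrank ℝ (ℝ ∙ u)ᗮ = (m + 1) * n - 1 := by
  have h1 := (ℝ ∙ u).finrank_add_finrank_orthogonal
  rw [finrank_span_singleton (by rintro rfl; simp at hu)] at h1
  have h2 : finrank ℝ (Space n m) = (m + 1) * n := by simp [mul_comm]
  omega

namespace FlatteningChart

variable {Ω : Set (Space n m)} {p : Space n m} {K : NNReal} {ε : ℝ} (c : FlatteningChart Ω p K ε)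
include c

/-- The open piece of the target hyperplane which parametrises the boundary. -/
def base : Set (ℝ ∙ c.u)ᗮ := {z | p + z ∈ c.Φ.target}

/-- The parametrisation of the boundary inside the chart by the target hyperplane. -/
def param (z : (ℝ ∙ c.u)ᗮ) : Space n m := c.Φ.symm (p + z)

/-- The inverse of the parametrisation. -/
def unparam (y : Space n m) : (ℝ ∙ c.u)ᗮ := (ℝ ∙ c.u)ᗮ.orthogonalProjectionOnto (c.Φ y - p)

lemma isOpen_base : IsOpen c.base :=
  c.Φ.open_target.preimage (by fun_prop : Continuous fun z : (ℝ ∙ c.u)ᗮ => p + (z : Space n m))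

lemma inner_coe (z : (ℝ ∙ c.u)ᗮ) : inner ℝ c.u (p + (z : Space n m) - p) = 0 := by
  rw [add_sub_cancel_left]
  exact Submodule.mem_orthogonal_singleton_iff_inner_right.1 z.2

lemma param_mem_source {z} (hz : z ∈ c.base) : c.param z ∈ c.Φ.source := c.Φ.map_target hz

lemma param_mem_frontier (hΩ : IsOpen Ω) {z} (hz : z ∈ c.base) : c.param z ∈ frontier Ω := by
  rw [c.mem_frontier_iff hΩ (c.param_mem_source hz), ← c.inner_eq _ (c.param_mem_source hz), param,
    c.Φ.right_inv hz, c.inner_coe]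

lemma coe_unparam (hΩ : IsOpen Ω) {y} (hy : y ∈ c.Φ.source) (hyf : y ∈ frontier Ω) :
    (c.unparam y : Space n m) = c.Φ y - p := by
  have h : c.Φ y - p ∈ (ℝ ∙ c.u)ᗮ := by
    rw [Submodule.mem_orthogonal_singleton_iff_inner_right, c.inner_eq y hy]
    exact (c.mem_frontier_iff hΩ hy).1 hyf
  exact congrArg Subtype.val ((ℝ ∙ c.u)ᗮ.orthogonalProjectionOnto_mem_subspace_eq_self ⟨_, h⟩)

lemma unparam_mem_base (hΩ : IsOpen Ω) {y} (hy : y ∈ c.Φ.source) (hyf : y ∈ frontier Ω) :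
    c.unparam y ∈ c.base := by
  simp only [base, mem_ofPred_eq, c.coe_unparam hΩ hy hyf, add_sub_cancel]
  exact c.Φ.map_source hy

lemma param_unparam (hΩ : IsOpen Ω) {y} (hy : y ∈ c.Φ.source) (hyf : y ∈ frontier Ω) :
    c.param (c.unparam y) = y := by
  rw [param, c.coe_unparam hΩ hy hyf, add_sub_cancel, c.Φ.left_inv hy]

lemma unparam_param {z} (hz : z ∈ c.base) : c.unparam (c.param z) = z := by
  rw [unparam, param, c.Φ.right_inv hz, add_sub_cancel_left]
  simp

lemma lipschitzOnWith_param : LipschitzOnWith K c.param c.base := by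
  refine LipschitzOnWith.of_dist_le_mul fun x hx y hy => ?_
  refine (c.lipschitz_symm.dist_le_mul _ hx _ hy).trans ?_
  rw [dist_add_left]
  rfl

lemma lipschitzOnWith_unparam : LipschitzOnWith K c.unparam c.Φ.source := by
  refine LipschitzOnWith.of_dist_le_mul fun x hx y hy => ?_
  refine le_trans ?_ (c.lipschitz.dist_le_mul _ hx _ hy)
  rw [dist_eq_norm, dist_eq_norm, unparam, unparam, ← map_sub, sub_sub_sub_cancel_right]
  exact Submodule.norm_orthogonalProjectionOnto_apply_le _ _

lemma volume_hyperplane :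
    (volume : Measure (ℝ ∙ c.u)ᗮ) = μHE[(m + 1) * n - 1] := by
  rw [← InnerProductSpace.euclideanHausdorffMeasure_eq_volume,
    finrank_orthogonal_of_norm_eq_one c.norm_u]

lemma aemeasurable_param : AEMeasurable c.param (volume.restrict c.base) :=
  c.lipschitzOnWith_param.continuousOn.aemeasurable c.isOpen_base.measurableSet

/-- Lebesgue measure on the hyperplane, transported to the boundary by the parametrisation. -/
def hyperplaneMeasure : Measure (Space n m) := (volume.restrict c.base).map c.param

lemma hyperplaneMeasure_apply {s : Set (Space n m)} (hs : MeasurableSet s) :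
    c.hyperplaneMeasure s = volume (c.param ⁻¹' s ∩ c.base) := by
  rw [hyperplaneMeasure, Measure.map_apply_of_aemeasurable c.aemeasurable_param hs,
    Measure.restrict_apply' c.isOpen_base.measurableSet]

lemma measurableSet_piece : MeasurableSet (frontier Ω ∩ c.Φ.source) :=
  isClosed_frontier.measurableSet.inter c.Φ.open_source.measurableSet

lemma hyperplaneMeasure_le (hΩ : IsOpen Ω) : c.hyperplaneMeasure ≤
    (K ^ ((m + 1) * n - 1)) • (surfaceMeasure n m).restrict (frontier Ω ∩ c.Φ.source) := by
  refine Measure.le_iff.2 fun s hs => ?_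
  rw [c.hyperplaneMeasure_apply hs, Measure.smul_apply, Measure.restrict_apply hs, ENNReal.smul_def,
    smul_eq_mul, c.volume_hyperplane]
  refine le_trans (measure_mono ?_) (euclideanHausdorffMeasure_image_le
    (c.lipschitzOnWith_unparam.mono (s := s ∩ (frontier Ω ∩ c.Φ.source)) fun y hy => hy.2.2) _)
  exact fun z hz => ⟨c.param z, ⟨hz.1, c.param_mem_frontier hΩ hz.2, c.param_mem_source hz.2⟩,
    c.unparam_param hz.2⟩

lemma restrict_surfaceMeasure_le (hΩ : IsOpen Ω) :
    (surfaceMeasure n m).restrict (frontier Ω ∩ c.Φ.source) ≤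
      (K ^ ((m + 1) * n - 1)) • c.hyperplaneMeasure := by
  refine Measure.le_iff.2 fun s hs => ?_
  rw [Measure.smul_apply, c.hyperplaneMeasure_apply hs, Measure.restrict_apply hs, ENNReal.smul_def,
    smul_eq_mul, c.volume_hyperplane]
  refine le_trans (measure_mono ?_) (euclideanHausdorffMeasure_image_le
    (c.lipschitzOnWith_param.mono (s := c.param ⁻¹' s ∩ c.base) fun y hy => hy.2) _)
  intro y hy
  refine ⟨c.unparam y, ⟨?_, c.unparam_mem_base hΩ hy.2.2 hy.2.1⟩, c.param_unparam hΩ hy.2.2 hy.2.1⟩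
  rw [mem_preimage, c.param_unparam hΩ hy.2.2 hy.2.1]
  exact hy.1

lemma norm_sub_le_of_mem_target {z : Space n m} (hz : z ∈ c.Φ.target) :
    ‖z - p‖ ≤ K + ‖c.Φ p - p‖ := by
  have h1 := c.lipschitz.dist_le_mul _ (c.Φ.map_target hz) _ c.mem_source
  rw [c.Φ.right_inv hz, dist_eq_norm] at h1
  have h2 : dist (c.Φ.symm z) p ≤ 1 := (c.source_subset (c.Φ.map_target hz)).le
  have h3 := norm_add_le (z - c.Φ p) (c.Φ p - p)
  rw [sub_add_sub_cancel] at h3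
  nlinarith [K.coe_nonneg]

lemma volume_base_lt_top : volume c.base < ⊤ := by
  refine lt_of_le_of_lt (measure_mono (t := Metric.closedBall 0 (K + ‖c.Φ p - p‖)) fun z hz => ?_)
    measure_closedBall_lt_top
  have := c.norm_sub_le_of_mem_target hz
  rw [add_sub_cancel_left] at this
  simpa using this

/-- The boundary has finite area inside the chart. -/
lemma surfaceMeasure_lt_top (hΩ : IsOpen Ω) :
    surfaceMeasure n m (frontier Ω ∩ c.Φ.source) < ⊤ := by
  have h := c.restrict_surfaceMeasure_le hΩ univ
  rw [Measure.restrict_apply_univ, Measure.smul_apply, c.hyperplaneMeasure_apply MeasurableSet.univ,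
    preimage_univ, univ_inter, ENNReal.smul_def, smul_eq_mul] at h
  exact h.trans_lt (ENNReal.mul_lt_top ENNReal.coe_lt_top c.volume_base_lt_top)

end FlatteningChart
end ChartMeasure

/-! ### Cut off fields in a chart -/

section Local

variable {n m : ℕ}

namespace FlatteningChart

variable {Ω : Set (Space n m)} {p : Space n m} {K : NNReal} {ε : ℝ} (c : FlatteningChart Ω p K ε)
include c

/-- The normal component of `Y` with respect to the height function, divided by the Jacobian of the
chart. -/
def flux (Y : Space n m → Space n m) (y : Space n m) : ℝ :=
  fderiv ℝ c.σ y (Y y) / |(c.Φ' y).det|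

lemma continuousOn_flux {Y : Space n m → Space n m} {s : Set (Space n m)} (hY : ContinuousOn Y s)
    (hs : s ⊆ c.Φ.source) : ContinuousOn (c.flux Y) s :=
  (((c.contDiffOn.continuousOn_fderiv_of_isOpen c.Φ.open_source le_rfl).mono hs).clm_apply hY).div
    (c.continuousOn_det.mono hs).abs fun _ hy => (c.det_pos (hs hy)).ne'

open Classical in
/-- The flux, transported by the chart to the closed half-space below the target hyperplane and
extended by zero. -/
def fluxBelow (Y : Space n m → Space n m) : Space n m → ℝ :=
  (c.Φ.target ∩ {z | inner ℝ c.u (z - p) ≤ 0}).piecewise (fun z => c.flux Y (c.Φ.symm z)) 0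

lemma symm_mem_closure {z : Space n m} (hz : z ∈ c.Φ.target) (hz0 : inner ℝ c.u (z - p) ≤ 0) :
    c.Φ.symm z ∈ closure Ω := by
  have h1 := c.Φ.map_target hz
  rwa [c.mem_closure_iff h1, ← c.inner_eq _ h1, c.Φ.right_inv hz]

lemma continuousOn_flux_symm {Y : Space n m → Space n m} (hY : ContinuousOn Y (closure Ω)) :
    ContinuousOn (fun z => c.flux Y (c.Φ.symm z))
      (c.Φ.target ∩ {z | inner ℝ c.u (z - p) ≤ 0}) := by
  have h := c.continuousOn_flux (hY.mono (inter_subset_left (t := c.Φ.source))) inter_subset_right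
  exact h.comp (c.Φ.continuousOn_symm.mono inter_subset_left) fun z hz =>
    ⟨c.symm_mem_closure hz.1 hz.2, c.Φ.map_target hz.1⟩

lemma fluxBelow_of_mem {Y : Space n m → Space n m} {z : Space n m} (hz : z ∈ c.Φ.target)
    (hz0 : inner ℝ c.u (z - p) ≤ 0) : c.fluxBelow Y z = c.flux Y (c.Φ.symm z) := by
  classical exact piecewise_eq_of_mem _ _ _ ⟨hz, hz0⟩

lemma fluxBelow_of_notMem_target {Y : Space n m → Space n m} {z : Space n m}
    (hz : z ∉ c.Φ.target) : c.fluxBelow Y z = 0 := by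
  classical exact piecewise_eq_of_notMem _ _ _ fun h => hz h.1

lemma measurable_fluxBelow {Y : Space n m → Space n m} (hY : ContinuousOn Y (closure Ω)) :
    Measurable (c.fluxBelow Y) := by
  classical
  refine (c.continuousOn_flux_symm hY).measurable_piecewise continuousOn_const ?_
  refine c.Φ.open_target.measurableSet.inter (IsClosed.measurableSet ?_)
  exact isClosed_le (by fun_prop) continuous_const

lemma mem_of_fluxBelow_ne_zero {Y : Space n m → Space n m} {S : Set (Space n m)}
    (hYS : ∀ y ∉ S, Y y = 0) {z : Space n m} (hz : c.fluxBelow Y z ≠ 0) :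
    z ∈ c.Φ.target ∧ inner ℝ c.u (z - p) ≤ 0 ∧ c.Φ.symm z ∈ S := by
  classical
  by_cases h : z ∈ c.Φ.target ∩ {z | inner ℝ c.u (z - p) ≤ 0}
  · refine ⟨h.1, h.2, ?_⟩
    by_contra hS
    apply hz
    rw [c.fluxBelow_of_mem h.1 h.2, flux, hYS _ hS, map_zero, zero_div]
  · exact absurd (piecewise_eq_of_notMem _ _ _ h) hz

lemma tendsto_integral_fluxBelow {Y : Space n m → Space n m} {S : Set (Space n m)}
    (hY : ContinuousOn Y (closure Ω)) (hS : IsCompact S) (hSs : S ⊆ c.Φ.source)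
    (hYS : ∀ y ∉ S, Y y = 0) :
    Tendsto (fun t : ℝ => ∫ z, t⁻¹ * deriv transition (-(inner ℝ c.u (z - p)) / t) *
      c.fluxBelow Y z) (𝓝[>] 0) (𝓝 (∫ z : (ℝ ∙ c.u)ᗮ, c.fluxBelow Y (p + z))) := by
  obtain ⟨Cw, hCw⟩ := continuous_deriv_transition.bounded_above_of_compact_support
    hasCompactSupport_deriv_transition
  have hcomp : IsCompact (S ∩ closure Ω) := hS.inter_right isClosed_closure
  obtain ⟨C, hC⟩ := hcomp.exists_bound_of_continuousOn
    (c.continuousOn_flux (hY.mono inter_subset_right) (inter_subset_left.trans hSs))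
  refine tendsto_integral_layer p c.u c.norm_u continuous_deriv_transition
    integrable_deriv_transition hCw (fun τ hτ => deriv_transition_of_lt (by linarith))
    integral_deriv_transition (c.measurable_fluxBelow hY) (C := max C 0)
    (R := K + ‖c.Φ p - p‖) ?_ ?_ ?_
  · intro y
    by_cases hy : c.fluxBelow Y y = 0
    · rw [hy, norm_zero]; exact le_max_right _ _
    · obtain ⟨h1, h2, h3⟩ := c.mem_of_fluxBelow_ne_zero hYS hy
      rw [c.fluxBelow_of_mem h1 h2]
      exact (hC _ ⟨h3, c.symm_mem_closure h1 h2⟩).trans (le_max_left _ _)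
  · intro y hy
    exact c.norm_sub_le_of_mem_target (c.mem_of_fluxBelow_ne_zero hYS hy).1
  · intro z
    have ht : Tendsto (fun s : ℝ => p + (-s) • c.u + (z : Space n m)) (𝓝[>] 0) (𝓝 (p + z)) := by
      have : Continuous fun s : ℝ => p + (-s) • c.u + (z : Space n m) := by fun_prop
      simpa using (this.tendsto 0).mono_left nhdsWithin_le_nhds
    by_cases hz : p + (z : Space n m) ∈ c.Φ.target
    · have h0 : inner ℝ c.u (p + (z : Space n m) - p) ≤ 0 := (c.inner_coe z).le
      have hev : ∀ᶠ s : ℝ in 𝓝[>] 0, p + (-s) • c.u + (z : Space n m) ∈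
          c.Φ.target ∩ {z | inner ℝ c.u (z - p) ≤ 0} := by
        filter_upwards [ht.eventually (c.Φ.open_target.mem_nhds hz), self_mem_nhdsWithin]
            with s hs hs0
        refine ⟨hs, ?_⟩
        have hs0 : (0 : ℝ) < s := hs0
        have : p + (-s) • c.u + (z : Space n m) - p = (p + (z : Space n m) - p) + (-s) • c.u := by
          abel
        rw [mem_ofPred_eq, this, inner_add_right, c.inner_coe, real_inner_smul_right,
          real_inner_self_eq_norm_sq, c.norm_u]
        linarith
      rw [c.fluxBelow_of_mem hz h0]
      refine ((c.continuousOn_flux_symm hY _ ⟨hz, h0⟩).tendsto.comp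
        (tendsto_nhdsWithin_iff.2 ⟨ht, hev⟩)).congr' ?_
      filter_upwards [hev] with s hs using (c.fluxBelow_of_mem hs.1 hs.2).symm
    · rw [c.fluxBelow_of_notMem_target hz]
      have hcl : IsClosed (c.Φ '' S) :=
          (hS.image_of_continuousOn (c.Φ.continuousOn.mono hSs)).isClosed
      have hn : p + (z : Space n m) ∉ c.Φ '' S := by
        rintro ⟨y, hy, h⟩
        exact hz (h ▸ c.Φ.map_source (hSs hy))
      refine tendsto_const_nhds.congr' ?_
      filter_upwards [ht.eventually (hcl.isOpen_compl.mem_nhds hn)] with s hs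
      by_contra h
      obtain ⟨h1, -, h3⟩ := c.mem_of_fluxBelow_ne_zero hYS (Ne.symm h)
      exact hs ⟨_, h3, c.Φ.right_inv h1⟩

/-- The divergence theorem in the chart, with the layer integral in place of the surface
integral: the field is cut off at height `t` below the boundary. -/
lemma integral_transition_mul_divergence {Y : Space n m → Space n m} {S : Set (Space n m)}
    (hΩ : IsOpen Ω) (hYd : ContDiffOn ℝ 1 Y Ω) (hS : IsCompact S) (hSs : S ⊆ c.Φ.source)
    (hYS : ∀ y ∉ S, Y y = 0) (hint : IntegrableOn (divergence Y) Ω) {t : ℝ} (ht : 0 < t) :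
    ∫ y in c.Φ.source ∩ Ω, transition (-c.σ y / t) * divergence Y y =
      ∫ z, t⁻¹ * deriv transition (-(inner ℝ c.u (z - p)) / t) * c.fluxBelow Y z := by
  classical
  set U := c.Φ.source ∩ Ω with hU
  have hUo : IsOpen U := c.Φ.open_source.inter hΩ
  set η : Space n m → ℝ := fun y => transition (-c.σ y / t) with hη
  set Z : Space n m → Space n m := U.indicator fun y => η y • Y y with hZ
  -- the support of the truncated field stays away from the boundary
  set T : Set (Space n m) := S ∩ c.σ ⁻¹' Iic (-t) with hT
  have hTc : IsCompact T := by
    refine hS.of_isClosed_subset ?_ inter_subset_left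
    exact (c.contDiffOn.continuousOn.mono hSs).preimage_isClosed_of_isClosed
        hS.isClosed isClosed_Iic
  have hTU : T ⊆ U := fun y hy => ⟨hSs hy.1, (c.mem_iff y (hSs hy.1)).2
    (lt_of_le_of_lt hy.2 (neg_lt_zero.2 ht))⟩
  have hZT : ∀ y ∉ T, Z y = 0 := by
    intro y hy
    by_cases hyU : y ∈ U
    · rw [hZ, indicator_of_mem hyU]
      by_cases hyS : y ∈ S
      · have h1 : -t < c.σ y := not_le.1 fun h => hy ⟨hyS, h⟩
        have h2 : η y = 0 := transition_of_le (by rw [div_le_one ht]; linarith)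
        rw [h2, zero_smul]
      · rw [hYS y hyS, smul_zero]
    · exact indicator_of_notMem hyU _
  have hηd : ContDiffOn ℝ 1 η U :=
    (contDiff_transition (k := 1)).comp_contDiffOn
      ((c.contDiffOn.mono inter_subset_left).neg.div_const t)
  have hZU : ContDiffOn ℝ 1 (fun y => η y • Y y) U := hηd.smul (hYd.mono inter_subset_right)
  have hZc : HasCompactSupport Z := HasCompactSupport.intro hTc hZT
  have hZev : ∀ y ∈ U, Z =ᶠ[𝓝 y] fun y => η y • Y y := fun y hy => by
    filter_upwards [hUo.mem_nhds hy] with x hx using indicator_of_mem hx _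
  have hZd : ContDiff ℝ 1 Z := by
    rw [contDiff_iff_contDiffAt]
    intro y
    by_cases hy : y ∈ U
    · exact (hZU.contDiffAt (hUo.mem_nhds hy)).congr_of_eventuallyEq (hZev y hy)
    · refine (contDiffAt_const (c := (0 : Space n m))).congr_of_eventuallyEq ?_
      filter_upwards [hTc.isClosed.isOpen_compl.mem_nhds fun h => hy (hTU h)]
          with x hx using hZT x hx
  have hdiv0 : ∀ y ∉ U, divergence Z y = 0 := fun y hy => by
    refine divergence_zero_of_eventuallyEq ?_
    filter_upwards [hTc.isClosed.isOpen_compl.mem_nhds fun h => hy (hTU h)] with x hx using hZT x hx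
  have hdiv : ∀ y ∈ U, divergence Z y = η y * divergence Y y -
      t⁻¹ * deriv transition (-c.σ y / t) * fderiv ℝ c.σ y (Y y) := by
    intro y hy
    have h1 : DifferentiableAt ℝ c.σ y := c.differentiableAt hy.1
    have h2 : DifferentiableAt ℝ Y y :=
        (hYd.contDiffAt (hΩ.mem_nhds hy.2)).differentiableAt (by simp)
    have h3 : HasFDerivAt η (deriv transition (-c.σ y / t) • (t⁻¹ • -fderiv ℝ c.σ y)) y := by
      have h4 : HasFDerivAt (fun y => -c.σ y / t) (t⁻¹ • -fderiv ℝ c.σ y) y := by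
        simpa [div_eq_inv_mul] using (h1.hasFDerivAt.neg.const_mul t⁻¹)
      exact (hasDerivAt_transition _).comp_hasFDerivAt y h4
    rw [divergence_congr (hZev y hy), divergence_smul h3.differentiableAt h2, h3.fderiv]
    simp only [smul_apply, neg_apply, smul_eq_mul]
    ring
  have hdc : Continuous (divergence Z) := by
    rw [← continuousOn_univ]
    exact continuousOn_divergence isOpen_univ hZd.contDiffOn
  have hdi : Integrable (divergence Z) := hdc.integrable_of_hasCompactSupport
    (HasCompactSupport.intro hTc fun y hy => divergence_zero_of_eventuallyEq (by
      filter_upwards [hTc.isClosed.isOpen_compl.mem_nhds hy] with x hx using hZT x hx))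
  have h1i : IntegrableOn (fun y => η y * divergence Y y) U := by
    refine (hint.mono_set inter_subset_right).bdd_mul (c := 1) ?_ ?_
    · exact hηd.continuousOn.aestronglyMeasurable hUo.measurableSet
    · exact Eventually.of_forall fun y => by
        rw [Real.norm_of_nonneg (transition_nonneg _)]; exact transition_le_one _
  have h2i : IntegrableOn (fun y => t⁻¹ * deriv transition (-c.σ y / t) *
      fderiv ℝ c.σ y (Y y)) U := by
    refine (h1i.sub hdi.integrableOn).congr_fun ?_ hUo.measurableSet
    intro y hy
    simp only [Pi.sub_apply]
    rw [hdiv y hy]; ring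
  have hzero : ∫ y in U, η y * divergence Y y =
      ∫ y in U, t⁻¹ * deriv transition (-c.σ y / t) * fderiv ℝ c.σ y (Y y) := by
    have h := integral_divergence_eq_zero hZd hZc
    rw [← setIntegral_eq_integral_of_forall_compl_eq_zero hdiv0,
      setIntegral_congr_fun hUo.measurableSet hdiv, integral_sub h1i h2i] at h
    linarith
  rw [hzero]
  -- change of variables by the chart
  have hout : ∀ z ∉ c.Φ '' U, t⁻¹ * deriv transition (-(inner ℝ c.u (z - p)) / t) *
      c.fluxBelow Y z = 0 := by
    intro z hz
    by_cases hzt : z ∈ c.Φ.target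
    · have h1 := c.Φ.map_target hzt
      have h2 : c.Φ.symm z ∉ Ω := fun h => hz ⟨_, ⟨h1, h⟩, c.Φ.right_inv hzt⟩
      rw [c.mem_iff _ h1, ← c.inner_eq _ h1, c.Φ.right_inv hzt, not_lt] at h2
      have h3 : -(inner ℝ c.u (z - p)) / t ≤ 0 := div_nonpos_of_nonpos_of_nonneg (by linarith) ht.le
      rw [deriv_transition_of_lt (by linarith)]
      ring
    · rw [c.fluxBelow_of_notMem_target hzt, mul_zero]
  rw [← setIntegral_eq_integral_of_forall_compl_eq_zero hout,
    integral_image_eq_integral_abs_det_fderiv_smul volume hUo.measurableSet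
      (fun y hy => (c.hasFDerivAt y hy.1).hasFDerivWithinAt)
      (c.Φ.injOn.mono inter_subset_left)]
  refine setIntegral_congr_fun hUo.measurableSet fun y hy => ?_
  have hσ : c.σ y < 0 := (c.mem_iff y hy.1).1 hy.2
  rw [c.fluxBelow_of_mem (c.Φ.map_source hy.1) (by rw [c.inner_eq y hy.1]; exact hσ.le),
    c.inner_eq y hy.1, c.Φ.left_inv hy.1, flux, smul_eq_mul]
  have := (c.det_pos hy.1).ne'
  field_simp

/-- The divergence theorem in the chart, with the surface integral expressed over the target
hyperplane. -/
lemma integral_divergence_eq_integral_fluxBelow {Y : Space n m → Space n m} {S : Set (Space n m)}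
    (hΩ : IsOpen Ω) (hY : ContinuousOn Y (closure Ω)) (hYd : ContDiffOn ℝ 1 Y Ω) (hS : IsCompact S)
    (hSs : S ⊆ c.Φ.source) (hYS : ∀ y ∉ S, Y y = 0) (hint : IntegrableOn (divergence Y) Ω) :
    ∫ y in Ω, divergence Y y = ∫ z : (ℝ ∙ c.u)ᗮ, c.fluxBelow Y (p + z) := by
  have hUo : IsOpen (c.Φ.source ∩ Ω) := c.Φ.open_source.inter hΩ
  have h0 : ∫ y in Ω, divergence Y y = ∫ y in c.Φ.source ∩ Ω, divergence Y y := by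
    refine setIntegral_eq_of_subset_of_forall_sdiff_eq_zero hΩ.measurableSet inter_subset_right ?_
    intro y hy
    refine divergence_zero_of_eventuallyEq ?_
    have : y ∉ S := fun h => hy.2 ⟨hSs h, hy.1⟩
    filter_upwards [hS.isClosed.isOpen_compl.mem_nhds this] with x hx using hYS x hx
  rw [h0]
  refine tendsto_nhds_unique ?_ (c.tendsto_integral_fluxBelow hY hS hSs hYS)
  refine Tendsto.congr' (f₁ := fun t : ℝ => ∫ y in c.Φ.source ∩ Ω,
    transition (-c.σ y / t) * divergence Y y) ?_ ?_
  · filter_upwards [self_mem_nhdsWithin] with t ht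
    exact c.integral_transition_mul_divergence hΩ hYd hS hSs hYS hint ht
  · have hint' := hint.mono_set (inter_subset_right : c.Φ.source ∩ Ω ⊆ Ω)
    refine tendsto_integral_filter_of_dominated_convergence (fun y => ‖divergence Y y‖) ?_ ?_
      hint'.norm ?_
    · refine Eventually.of_forall fun t => AEStronglyMeasurable.mul ?_ hint'.aestronglyMeasurable
      refine ContinuousOn.aestronglyMeasurable ?_ hUo.measurableSet
      exact (contDiff_transition (k := 1)).continuous.comp_continuousOn
        ((c.contDiffOn.continuousOn.mono inter_subset_left).neg.div_const t)
    · refine Eventually.of_forall fun t => Eventually.of_forall fun y => ?_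
      rw [norm_mul, Real.norm_of_nonneg (transition_nonneg _)]
      exact mul_le_of_le_one_left (norm_nonneg _) (transition_le_one _)
    · refine (ae_restrict_iff' hUo.measurableSet).2 (Eventually.of_forall fun y hy => ?_)
      have hσ : c.σ y < 0 := (c.mem_iff y hy.1).1 hy.2
      refine tendsto_const_nhds.congr' ?_
      have : ∀ᶠ t : ℝ in 𝓝[>] 0, t < -c.σ y / 2 :=
        nhdsWithin_le_nhds (gt_mem_nhds (by linarith))
      filter_upwards [this, self_mem_nhdsWithin] with t ht ht0
      rw [transition_of_ge, one_mul]
      rw [le_div_iff₀ ht0]; linarith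

end FlatteningChart
end Local

/-! ### The local divergence theorem up to a small error -/

section LocalEstimate

variable {n m : ℕ}

namespace FlatteningChart

variable {Ω : Set (Space n m)} {p : Space n m} {K : NNReal} {ε : ℝ} (c : FlatteningChart Ω p K ε)
include c

lemma inner_exteriorNormal (hΩ : IsOpen Ω) {y : Space n m} (hy : y ∈ frontier Ω ∩ c.Φ.source)
    (v : Space n m) :
    inner ℝ (exteriorNormal Ω y) v = fderiv ℝ c.σ y v / ‖fderiv ℝ c.σ y‖ := by
  rw [c.exteriorNormal_eq hΩ hy.2 hy.1, real_inner_smul_left, inner_gradient, div_eq_inv_mul]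

lemma continuousOn_exteriorNormal (hΩ : IsOpen Ω) :
    ContinuousOn (exteriorNormal Ω) (frontier Ω ∩ c.Φ.source) := by
  have h : ContinuousOn (fderiv ℝ c.σ) (frontier Ω ∩ c.Φ.source) :=
    (c.contDiffOn.continuousOn_fderiv_of_isOpen c.Φ.open_source le_rfl).mono inter_subset_right
  refine ContinuousOn.congr (f := fun y => ‖fderiv ℝ c.σ y‖⁻¹ • gradient c.σ y) ?_ fun y hy =>
    c.exteriorNormal_eq hΩ hy.2 hy.1
  refine (h.norm.inv₀ fun y hy => norm_ne_zero_iff.2 (c.fderiv_ne_zero y hy.2)).smul ?_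
  exact (InnerProductSpace.toDual ℝ (Space n m)).symm.continuous.comp_continuousOn h

lemma abs_flux_sub_le (hΩ : IsOpen Ω) (Y : Space n m → Space n m) {y : Space n m}
    (hy : y ∈ frontier Ω ∩ c.Φ.source) :
    |c.flux Y y - inner ℝ (exteriorNormal Ω y) (Y y)| ≤ ε * ‖Y y‖ := by
  have h1 : ‖fderiv ℝ c.σ y‖ ≠ 0 := norm_ne_zero_iff.2 (c.fderiv_ne_zero y hy.2)
  have h2 := (c.det_pos hy.2).ne'
  have h3 : c.flux Y y - inner ℝ (exteriorNormal Ω y) (Y y) =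
      (‖fderiv ℝ c.σ y‖ / |(c.Φ' y).det| - 1) * inner ℝ (exteriorNormal Ω y) (Y y) := by
    rw [flux, c.inner_exteriorNormal hΩ hy]
    field_simp
  rw [h3, abs_mul]
  have h4 : |inner ℝ (exteriorNormal Ω y) (Y y)| ≤ ‖Y y‖ :=
    (abs_real_inner_le_norm _ _).trans
      (mul_le_of_le_one_left (norm_nonneg _) (norm_exteriorNormal_le _ _))
  exact mul_le_mul (c.ratio y hy.2) h4 (abs_nonneg _) ((abs_nonneg _).trans (c.ratio y hy.2))

lemma abs_flux_le (hΩ : IsOpen Ω) (Y : Space n m → Space n m) {y : Space n m}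
    (hy : y ∈ frontier Ω ∩ c.Φ.source) : |c.flux Y y| ≤ (1 + ε) * ‖Y y‖ := by
  have h1 := c.abs_flux_sub_le hΩ Y hy
  have h4 : |inner ℝ (exteriorNormal Ω y) (Y y)| ≤ ‖Y y‖ :=
    (abs_real_inner_le_norm _ _).trans
      (mul_le_of_le_one_left (norm_nonneg _) (norm_exteriorNormal_le _ _))
  rw [abs_le] at *
  constructor <;> linarith [h1.1, h1.2, h4.1, h4.2]

/-- The divergence theorem for fields supported in the chart, up to an error which is controlled by
the distortion of the chart. -/
lemma abs_integral_divergence_sub_le (hΩ : IsOpen Ω) (hK : 1 ≤ K) {Y : Space n m → Space n m}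
    {S : Set (Space n m)} (hY : ContinuousOn Y (closure Ω)) (hYd : ContDiffOn ℝ 1 Y Ω)
    (hS : IsCompact S) (hSs : S ⊆ c.Φ.source) (hYS : ∀ y ∉ S, Y y = 0)
    (hint : IntegrableOn (divergence Y) Ω) :
    |(∫ y in Ω, divergence Y y) -
        ∫ y in frontier Ω, inner ℝ (exteriorNormal Ω y) (Y y) ∂(surfaceMeasure n m)| ≤
      ((K ^ ((m + 1) * n - 1) * K ^ ((m + 1) * n - 1) - 1) * (1 + ε) + ε) *
        ∫ y in frontier Ω, ‖Y y‖ ∂(surfaceMeasure n m) := by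
  set T := frontier Ω ∩ c.Φ.source with hT
  set κ : NNReal := K ^ ((m + 1) * n - 1) with hκ
  have hκ1 : 1 ≤ κ := one_le_pow₀ hK
  have hε : 0 ≤ ε := (abs_nonneg _).trans (c.ratio p c.mem_source)
  have hTm : MeasurableSet T := c.measurableSet_piece
  have hTfin : surfaceMeasure n m T ≠ ⊤ := (c.surfaceMeasure_lt_top hΩ).ne
  have hYT : ContinuousOn Y T := hY.mono fun y hy => frontier_subset_closure hy.1
  have hout : ∀ y ∈ frontier Ω \ T, Y y = 0 := fun y hy =>
    hYS y fun h => hy.2 ⟨hy.1, hSs h⟩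
  -- integrability over the boundary piece
  obtain ⟨C, hC⟩ := (hS.inter_right (isClosed_closure (s := Ω))).exists_bound_of_continuousOn
    (hY.mono inter_subset_right)
  have hYb : ∀ y ∈ T, ‖Y y‖ ≤ max C 0 := fun y hy => by
    by_cases h : y ∈ S
    · exact (hC y ⟨h, frontier_subset_closure hy.1⟩).trans (le_max_left _ _)
    · rw [hYS y h, norm_zero]; exact le_max_right _ _
  have hYi : IntegrableOn Y T (surfaceMeasure n m) :=
    (integrableOn_const hTfin (C := max C 0)).mono' (hYT.aestronglyMeasurable hTm)
      ((ae_restrict_iff' hTm).2 (Eventually.of_forall hYb))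
  have hqc : ContinuousOn (c.flux Y) T := c.continuousOn_flux hYT inter_subset_right
  have hqi : IntegrableOn (c.flux Y) T (surfaceMeasure n m) :=
    (hYi.norm.const_mul (1 + ε)).mono' (hqc.aestronglyMeasurable hTm)
      ((ae_restrict_iff' hTm).2 (Eventually.of_forall fun y hy => c.abs_flux_le hΩ Y hy))
  have hνi : IntegrableOn (fun y => inner ℝ (exteriorNormal Ω y) (Y y)) T (surfaceMeasure n m) := by
    refine hYi.norm.mono' (((c.continuousOn_exteriorNormal hΩ).inner hYT).aestronglyMeasurable hTm)
      (Eventually.of_forall fun y => ?_)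
    exact (norm_inner_le_norm _ _).trans
      (mul_le_of_le_one_left (norm_nonneg _) (norm_exteriorNormal_le _ _))
  have e1 : ∫ y in frontier Ω, inner ℝ (exteriorNormal Ω y) (Y y) ∂(surfaceMeasure n m) =
      ∫ y in T, inner ℝ (exteriorNormal Ω y) (Y y) ∂(surfaceMeasure n m) :=
    setIntegral_eq_of_subset_of_forall_sdiff_eq_zero isClosed_frontier.measurableSet
      inter_subset_left fun y hy => by rw [hout y hy, inner_zero_right]
  have e2 : ∫ y in frontier Ω, ‖Y y‖ ∂(surfaceMeasure n m) =
      ∫ y in T, ‖Y y‖ ∂(surfaceMeasure n m) :=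
    setIntegral_eq_of_subset_of_forall_sdiff_eq_zero isClosed_frontier.measurableSet
      inter_subset_left fun y hy => by rw [hout y hy, norm_zero]
  -- the hyperplane integral is an integral over the boundary piece
  have e3 : ∫ y in Ω, divergence Y y = ∫ y, c.flux Y y ∂c.hyperplaneMeasure := by
    rw [c.integral_divergence_eq_integral_fluxBelow hΩ hY hYd hS hSs hYS hint, hyperplaneMeasure,
      integral_map c.aemeasurable_param]
    · rw [← setIntegral_eq_integral_of_forall_compl_eq_zero (s := c.base)
        fun z hz => c.fluxBelow_of_notMem_target hz]
      exact setIntegral_congr_fun c.isOpen_base.measurableSet fun z hz =>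
        c.fluxBelow_of_mem hz (c.inner_coe z).le
    · exact ((hqc.aestronglyMeasurable hTm).smul_measure κ).mono_measure (c.hyperplaneMeasure_le hΩ)
  have b1 := abs_integral_sub_integral_le (c.hyperplaneMeasure_le hΩ)
    (c.restrict_surfaceMeasure_le hΩ) hκ1 hqi
  have b2 : ∫ y in T, |c.flux Y y| ∂(surfaceMeasure n m) ≤
      (1 + ε) * ∫ y in T, ‖Y y‖ ∂(surfaceMeasure n m) := by
    rw [← integral_const_mul]
    exact setIntegral_mono_on hqi.abs (hYi.norm.const_mul _) hTm fun y hy => c.abs_flux_le hΩ Y hy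
  have b3 : |(∫ y in T, c.flux Y y ∂(surfaceMeasure n m)) -
      ∫ y in T, inner ℝ (exteriorNormal Ω y) (Y y) ∂(surfaceMeasure n m)| ≤
      ε * ∫ y in T, ‖Y y‖ ∂(surfaceMeasure n m) := by
    rw [← integral_sub hqi hνi, ← integral_const_mul]
    refine abs_integral_le_integral_abs.trans ?_
    exact setIntegral_mono_on (hqi.sub hνi).abs (hYi.norm.const_mul _) hTm
      fun y hy => c.abs_flux_sub_le hΩ Y hy
  rw [e1, e2, e3]
  have hκr : (0 : ℝ) ≤ κ * κ - 1 := by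
    have : (1 : ℝ) ≤ κ := by exact_mod_cast hκ1
    nlinarith
  have hκe : (κ : ℝ) = (K : ℝ) ^ ((m + 1) * n - 1) := by rw [hκ]; simp
  rw [← hκe]
  refine (abs_sub_le _ (∫ y in T, c.flux Y y ∂(surfaceMeasure n m)) _).trans ?_
  refine (add_le_add (b1.trans (mul_le_mul_of_nonneg_left b2 hκr)) b3).trans (le_of_eq ?_)
  ring

end FlatteningChart

/-- Near a smooth boundary point, the divergence theorem holds with an arbitrarily small relative
error, and the boundary has finite area. -/
theorem exists_nhds_abs_integral_divergence_sub_le {Ω : Set (Space n m)} (hΩ : IsOpen Ω)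
    {p : Space n m} (hp : IsSmoothBoundaryPoint Ω p) {ε : ℝ} (hε : 0 < ε) :
    ∃ V : Set (Space n m), IsOpen V ∧ p ∈ V ∧ surfaceMeasure n m (frontier Ω ∩ V) < ⊤ ∧
      ContinuousOn (exteriorNormal Ω) (frontier Ω ∩ V) ∧
      (∀ y ∈ frontier Ω ∩ V, IsSmoothBoundaryPoint Ω y) ∧
      ∀ (Y : Space n m → Space n m) (S : Set (Space n m)), ContinuousOn Y (closure Ω) →
        ContDiffOn ℝ 1 Y Ω → IsCompact S → S ⊆ V → (∀ y ∉ S, Y y = 0) →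
        IntegrableOn (divergence Y) Ω →
        |(∫ y in Ω, divergence Y y) -
            ∫ y in frontier Ω, inner ℝ (exteriorNormal Ω y) (Y y) ∂(surfaceMeasure n m)| ≤
          ε * ∫ y in frontier Ω, ‖Y y‖ ∂(surfaceMeasure n m) := by
  obtain ⟨ν, ρ, hρ, -⟩ := hp
  set d := (m + 1) * n - 1
  have hcont : Continuous fun K : NNReal => (K : ℝ) ^ d * (K : ℝ) ^ d := by fun_prop
  have hev : ∀ᶠ K : NNReal in 𝓝[>] 1, (K : ℝ) ^ d * (K : ℝ) ^ d < 1 + ε / 4 :=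
    (hcont.tendsto 1).mono_left nhdsWithin_le_nhds |>.eventually (gt_mem_nhds (by simp [hε]))
  obtain ⟨K, hK2, hK1⟩ := (hev.and self_mem_nhdsWithin).exists
  have hK1 : 1 < K := hK1
  obtain ⟨c⟩ := exists_flatteningChart hρ hK1 (ε := min 1 (ε / 2)) (by positivity)
  refine ⟨c.Φ.source, c.Φ.open_source, c.mem_source, c.surfaceMeasure_lt_top hΩ,
    c.continuousOn_exteriorNormal hΩ,
    fun y hy => ⟨_, c.σ, c.isDefiningFunctionAt hΩ hy.2 hy.1, rfl⟩, ?_⟩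
  intro Y S hY hYd hS hSs hYS hint
  refine (c.abs_integral_divergence_sub_le hΩ hK1.le hY hYd hS hSs hYS hint).trans ?_
  refine mul_le_mul_of_nonneg_right ?_ (integral_nonneg fun _ => norm_nonneg _)
  have h1 : min 1 (ε / 2) ≤ 1 := min_le_left _ _
  have h2 : min 1 (ε / 2) ≤ ε / 2 := min_le_right _ _
  have h3 : 0 < min 1 (ε / 2) := by positivity
  nlinarith

end LocalEstimate

/-! ### Cutoffs around the singular set -/

section SingularCutoff

variable {n m : ℕ}

/-- A compact set of zero surface measure is covered by finitely many small balls with small total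
`((m+1)n-1)`-dimensional size. -/
lemma exists_ball_cover {S : Set (Space n m)} (hS : IsCompact S) (h0 : surfaceMeasure n m S = 0)
    {ε : ℝ} (hε : 0 < ε) :
    ∃ (J : Finset ℕ) (x : ℕ → Space n m) (r : ℕ → ℝ), (∀ k ∈ J, x k ∈ S) ∧ (∀ k, 0 < r k) ∧
      (∀ k, r k < ε) ∧ S ⊆ ⋃ k ∈ J, Metric.ball (x k) (r k) ∧
      ∑ k ∈ J, r k ^ ((m + 1) * n - 1) ≤ ε := by
  set d := (m + 1) * n - 1
  have hH : (μH[(d : ℝ)] : Measure (Space n m)) S = 0 := by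
    have h1 := h0
    rw [surfaceMeasure, Measure.euclideanHausdorffMeasure_def, Measure.smul_apply,
      ENNReal.smul_def, smul_eq_mul, mul_eq_zero] at h1
    refine h1.resolve_left ?_
    exact_mod_cast Measure.addHaarScalarFactor_volume_hausdorffMeasure_ne_zero d
  rw [Measure.hausdorffMeasure_apply] at hH
  have h1 := (ENNReal.iSup_eq_zero.1 (ENNReal.iSup_eq_zero.1 hH (ENNReal.ofReal (ε / 2))))
    (ENNReal.ofReal_pos.2 (half_pos hε))
  have h2 : _ < ENNReal.ofReal (ε / 2) := h1.trans_lt (ENNReal.ofReal_pos.2 (half_pos hε))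
  simp only [iInf_lt_iff] at h2
  obtain ⟨t, hSt, htd, hsum⟩ := h2
  -- radii slightly larger than the diameters
  obtain ⟨η, hη0, hηs⟩ : ∃ η : ℕ → ℝ, (∀ k, 0 < η k) ∧ ∀ J : Finset ℕ, ∑ k ∈ J, η k ≤ ε / 2 := by
    obtain ⟨η, h1, c, h2, h3⟩ := posSumOfEncodable (half_pos hε) ℕ
    exact ⟨η, h1, fun J => (sum_le_hasSum J (fun k _ => (h1 k).le) h2).trans h3⟩
  have ha : ∀ k, (Metric.ediam (t k)).toReal ≤ ε / 2 := fun k =>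
    ENNReal.toReal_le_of_le_ofReal (half_pos hε).le (htd k)
  have hr : ∀ k, ∃ r : ℝ, (Metric.ediam (t k)).toReal < r ∧ r < ε ∧
      r ^ d < (Metric.ediam (t k)).toReal ^ d + η k := by
    intro k
    set a := (Metric.ediam (t k)).toReal
    have hc : Continuous fun r : ℝ => r ^ d := by fun_prop
    have e1 : ∀ᶠ r in 𝓝[>] a, r ^ d < a ^ d + η k := ((hc.tendsto a).mono_left
      nhdsWithin_le_nhds).eventually (gt_mem_nhds (by simp [hη0 k]))
    have e2 : ∀ᶠ r in 𝓝[>] a, r < ε :=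
      nhdsWithin_le_nhds (gt_mem_nhds (lt_of_le_of_lt (ha k) (by linarith)))
    obtain ⟨r, h1, h2, h3⟩ := (e1.and (e2.and self_mem_nhdsWithin)).exists
    exact ⟨r, h3, h2, h1⟩
  choose r hr1 hr2 hr3 using hr
  have hr0 : ∀ k, 0 < r k := fun k => ENNReal.toReal_nonneg.trans_lt (hr1 k)
  classical
  choose! x hx using fun k (h : (t k ∩ S).Nonempty) => h
  have hcover : S ⊆ ⋃ k : {k | (t k ∩ S).Nonempty}, Metric.ball (x k) (r k) := by
    intro y hy
    obtain ⟨k, hk⟩ := mem_iUnion.1 (hSt hy)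
    have hne : (t k ∩ S).Nonempty := ⟨y, hk, hy⟩
    refine mem_iUnion.2 ⟨⟨k, hne⟩, ?_⟩
    rw [Metric.mem_ball]
    refine lt_of_le_of_lt ?_ (hr1 k)
    rw [dist_edist]
    exact ENNReal.toReal_mono (ne_top_of_le_ne_top ENNReal.ofReal_ne_top (htd k))
      (Metric.edist_le_ediam_of_mem hk (hx k hne).1)
  obtain ⟨J, hJ⟩ := hS.elim_finite_subcover _ (fun k => Metric.isOpen_ball) hcover
  refine ⟨J.image Subtype.val, x, r, ?_, hr0, hr2, ?_, ?_⟩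
  · intro k hk
    obtain ⟨k', -, rfl⟩ := Finset.mem_image.1 hk
    exact (hx _ k'.2).2
  · refine hJ.trans (iUnion₂_subset fun k hk => ?_)
    exact subset_biUnion_of_mem (u := fun k => Metric.ball (x k) (r k))
      (Finset.mem_image_of_mem _ hk : (k : ℕ) ∈ J.image Subtype.val)
  · set J' := J.image Subtype.val with hJ'
    have hne : ∀ k ∈ J', (t k).Nonempty := fun k hk => by
      obtain ⟨k', -, rfl⟩ := Finset.mem_image.1 hk
      exact k'.2.mono inter_subset_left
    have hs1 : ∑ k ∈ J', Metric.ediam (t k) ^ (d : ℝ) ≤ ENNReal.ofReal (ε / 2) := by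
      refine le_trans ?_ hsum.le
      refine le_trans (Finset.sum_le_sum fun k hk => ?_) (ENNReal.sum_le_tsum J')
      exact le_iSup_of_le (hne k hk) le_rfl
    have hs2 : ∑ k ∈ J', (Metric.ediam (t k)).toReal ^ d ≤ ε / 2 := by
      have := ENNReal.toReal_le_of_le_ofReal (half_pos hε).le hs1
      rw [ENNReal.toReal_sum] at this
      · simpa using this
      · intro k _
        simpa using ENNReal.pow_ne_top (ne_top_of_le_ne_top ENNReal.ofReal_ne_top (htd k))
    calc ∑ k ∈ J', r k ^ d ≤ ∑ k ∈ J', ((Metric.ediam (t k)).toReal ^ d + η k) :=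
          Finset.sum_le_sum fun k _ => (hr3 k).le
      _ ≤ ε / 2 + ε / 2 := by rw [Finset.sum_add_distrib]; exact add_le_add hs2 (hηs J')
      _ = ε := add_halves ε

/-- The `L¹` norm of the gradient of a rescaled function. -/
lemma integral_norm_fderiv_rescale {χ : Space n m → ℝ} (hχ : ContDiff ℝ 1 χ) (x : Space n m)
    {r : ℝ} (hr : 0 < r) (hd : (m + 1) * n ≠ 0) :
    ∫ y, ‖fderiv ℝ (fun y => χ (r⁻¹ • (y - x))) y‖ =
      r ^ ((m + 1) * n - 1) * ∫ y, ‖fderiv ℝ χ y‖ := by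
  have h1 : ∀ y, ‖fderiv ℝ (fun y => χ (r⁻¹ • (y - x))) y‖ =
      r⁻¹ * ‖fderiv ℝ χ (r⁻¹ • (y - x))‖ := by
    intro y
    have h2 : HasFDerivAt (fun y => r⁻¹ • (y - x)) (r⁻¹ • ContinuousLinearMap.id ℝ (Space n m)) y :=
      ((hasFDerivAt_id y).sub_const x).const_smul r⁻¹
    have h3 := ((hχ.differentiable (by simp) (r⁻¹ • (y - x))).hasFDerivAt).comp y h2
    have h4 : (fderiv ℝ χ (r⁻¹ • (y - x))).comp (r⁻¹ • ContinuousLinearMap.id ℝ (Space n m)) =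
        r⁻¹ • fderiv ℝ χ (r⁻¹ • (y - x)) := by ext v; simp
    rw [h4] at h3
    have h5 := h3.fderiv
    simp only [Function.comp_def] at h5
    rw [h5, norm_smul, norm_inv, Real.norm_of_nonneg hr.le]
  simp_rw [h1]
  rw [integral_const_mul, integral_sub_right_eq_self (fun y => ‖fderiv ℝ χ (r⁻¹ • y)‖) x,
    Measure.integral_comp_inv_smul_of_nonneg volume (fun y => ‖fderiv ℝ χ y‖) hr.le, smul_eq_mul,
    ← mul_assoc]
  congr 1
  have h2 : finrank ℝ (Space n m) = ((m + 1) * n - 1) + 1 := by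
    rw [Nat.sub_add_cancel (Nat.one_le_iff_ne_zero.2 hd)]; simp [mul_comm]
  rw [h2, pow_succ]
  field_simp

lemma contDiff_and_norm_fderiv_prod_le (J : Finset ℕ) {χ : ℕ → Space n m → ℝ}
    (hχ : ∀ k, ContDiff ℝ 1 (χ k)) (h0 : ∀ k y, 0 ≤ χ k y) (h1 : ∀ k y, χ k y ≤ 1) :
    ContDiff ℝ 1 (fun y => ∏ k ∈ J, (1 - χ k y)) ∧
      (∀ y, 0 ≤ ∏ k ∈ J, (1 - χ k y)) ∧ (∀ y, ∏ k ∈ J, (1 - χ k y) ≤ 1) ∧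
      ∀ y, ‖fderiv ℝ (fun y => ∏ k ∈ J, (1 - χ k y)) y‖ ≤ ∑ k ∈ J, ‖fderiv ℝ (χ k) y‖ := by
  have hc : ∀ J : Finset ℕ, ContDiff ℝ 1 (fun y => ∏ k ∈ J, (1 - χ k y)) := fun J =>
    contDiff_prod fun k _ => contDiff_const.sub (hχ k)
  have hp : ∀ (J : Finset ℕ) y, 0 ≤ ∏ k ∈ J, (1 - χ k y) := fun J y =>
    Finset.prod_nonneg fun k _ => sub_nonneg.2 (h1 k y)
  have hl : ∀ (J : Finset ℕ) y, ∏ k ∈ J, (1 - χ k y) ≤ 1 := fun J y =>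
    Finset.prod_le_one (fun k _ => sub_nonneg.2 (h1 k y)) fun k _ => sub_le_self _ (h0 k y)
  refine ⟨hc J, hp J, hl J, fun y => ?_⟩
  induction J using Finset.induction_on with
  | empty => simp
  | insert a J ha ih =>
    rw [Finset.sum_insert ha]
    have he : (fun y => ∏ k ∈ insert a J, (1 - χ k y)) =
        fun y => (1 - χ a y) * ∏ k ∈ J, (1 - χ k y) := by
      ext y; rw [Finset.prod_insert ha]
    have hda : DifferentiableAt ℝ (χ a) y := (hχ a).differentiable (by simp) y
    rw [he, fderiv_fun_mul
        (DifferentiableAt.fun_sub (differentiableAt_const _) hda) ((hc J).differentiable (by simp) y),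
      fderiv_const_sub]
    refine (norm_add_le _ _).trans ?_
    rw [norm_smul, norm_smul, norm_neg, add_comm, Real.norm_of_nonneg (hp J y),
      Real.norm_of_nonneg (sub_nonneg.2 (h1 a y))]
    refine add_le_add (mul_le_of_le_one_left (norm_nonneg _) (hl J y)) ?_
    exact (mul_le_of_le_one_left (norm_nonneg _) (sub_le_self _ (h0 a y))).trans ih

/-- A compact set of zero surface measure is removed by `C¹` cutoffs whose gradients are small in
`L¹`. -/
lemma exists_cutoff {S : Set (Space n m)} (hS : IsCompact S) (h0 : surfaceMeasure n m S = 0)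
    (hd : (m + 1) * n ≠ 0) {ε : ℝ} (hε : 0 < ε) :
    ∃ φ : Space n m → ℝ, ContDiff ℝ 1 φ ∧ (∀ y, 0 ≤ φ y) ∧ (∀ y, φ y ≤ 1) ∧
      (∃ W, IsOpen W ∧ S ⊆ W ∧ ∀ y ∈ W, φ y = 0) ∧ (∀ y, (∀ x ∈ S, ε ≤ dist y x) → φ y = 1) ∧
      Integrable (fun y => ‖fderiv ℝ φ y‖) ∧ ∫ y, ‖fderiv ℝ φ y‖ ≤ ε := by
  let b : ContDiffBump (0 : Space n m) := ⟨1, 2, one_pos, one_lt_two⟩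
  have hb : ContDiff ℝ 1 b := b.contDiff
  set C := ∫ y, ‖fderiv ℝ b y‖ with hC
  have hC0 : 0 ≤ C := integral_nonneg fun _ => norm_nonneg _
  set δ := min (ε / 2) (ε / (C + 1)) with hδ
  have hδ0 : 0 < δ := by positivity
  obtain ⟨J, x, r, hxS, hr0, hrδ, hcov, hsum⟩ := exists_ball_cover hS h0 hδ0
  set χ : ℕ → Space n m → ℝ := fun k y => b ((r k)⁻¹ • (y - x k)) with hχ
  have hχc : ∀ k, ContDiff ℝ 1 (χ k) := fun k =>
    hb.comp (by fun_prop)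
  have hχs : ∀ k y, 2 * r k ≤ dist y (x k) → χ k y = 0 := fun k y h => by
    refine b.zero_of_le_dist ?_
    rw [dist_zero_right, norm_smul, norm_inv, Real.norm_of_nonneg (hr0 k).le, ← dist_eq_norm,
      inv_mul_eq_div, le_div_iff₀ (hr0 k)]
    exact h
  obtain ⟨p1, p2, p3, p4⟩ := contDiff_and_norm_fderiv_prod_le J hχc
    (fun k y => b.nonneg) (fun k y => b.le_one)
  have hint : ∀ k, Integrable fun y => ‖fderiv ℝ (χ k) y‖ := by
    intro k
    have hcs : HasCompactSupport (χ k) :=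
      HasCompactSupport.intro (isCompact_closedBall (x k) (2 * r k)) fun y hy =>
        hχs k y (not_le.1 hy).le
    exact ((hχc k).continuous_fderiv (by simp)).norm.integrable_of_hasCompactSupport
      (hcs.fderiv ℝ).norm
  refine ⟨fun y => ∏ k ∈ J, (1 - χ k y), p1, p2, p3, ?_, ?_, ?_, ?_⟩
  · refine ⟨⋃ k ∈ J, Metric.ball (x k) (r k),
      isOpen_biUnion fun _ _ => Metric.isOpen_ball, hcov, ?_⟩
    intro y hy
    obtain ⟨k, hk, hy⟩ := mem_iUnion₂.1 hy
    refine Finset.prod_eq_zero hk ?_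
    rw [sub_eq_zero, eq_comm]
    refine b.one_of_mem_closedBall ?_
    rw [mem_closedBall_zero_iff, norm_smul, norm_inv, Real.norm_of_nonneg (hr0 k).le,
      ← dist_eq_norm, inv_mul_eq_div, div_le_iff₀ (hr0 k)]
    rw [show b.rIn = 1 from rfl, one_mul]
    exact (Metric.mem_ball.1 hy).le
  · intro y hy
    refine Finset.prod_eq_one fun k hk => ?_
    rw [hχs k y, sub_zero]
    have h1 := hy _ (hxS k hk)
    have h2 := hrδ k
    have h3 : δ ≤ ε / 2 := min_le_left _ _
    linarith
  · refine (integrable_finsetSum J fun k _ => hint k).mono' ?_ (Eventually.of_forall fun y => ?_)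
    · exact (p1.continuous_fderiv (by simp)).norm.aestronglyMeasurable
    · rw [norm_norm]; exact p4 y
  · have hsi := integrable_finsetSum J fun k _ => hint k
    calc ∫ y, ‖fderiv ℝ (fun y => ∏ k ∈ J, (1 - χ k y)) y‖
        ≤ ∫ y, ∑ k ∈ J, ‖fderiv ℝ (χ k) y‖ :=
          integral_mono_of_nonneg (Eventually.of_forall fun _ => norm_nonneg _) hsi
            (Eventually.of_forall p4)
      _ = ∑ k ∈ J, r k ^ ((m + 1) * n - 1) * C := by
          rw [integral_finsetSum _ fun k _ => hint k]
          exact Finset.sum_congr rfl fun k _ =>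
            integral_norm_fderiv_rescale hb (x k) (hr0 k) hd
      _ ≤ δ * C := by rw [← Finset.sum_mul]; gcongr
      _ ≤ ε / (C + 1) * C := by gcongr; exact min_le_right _ _
      _ ≤ ε := by
          rw [div_mul_eq_mul_div, div_le_iff₀ (by linarith)]
          nlinarith

end SingularCutoff

/-! ### The divergence theorem -/

section DivergenceTheorem

variable {n m : ℕ} {Ω : Set (Space n m)}

/-- The smooth boundary points form a relatively open subset of the boundary, on which the exterior
normal is continuous. -/
lemma exists_isOpen_smooth_eq (hΩ : IsOpen Ω) :
    ∃ O : Set (Space n m), IsOpen O ∧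
        {p ∈ frontier Ω | IsSmoothBoundaryPoint Ω p} = frontier Ω ∩ O ∧
      ContinuousOn (exteriorNormal Ω) (frontier Ω ∩ O) := by
  choose! V hVo hpV _ hVc hVs _ using fun p (hp : IsSmoothBoundaryPoint Ω p) =>
    exists_nhds_abs_integral_divergence_sub_le hΩ hp one_pos
  have he : {p ∈ frontier Ω | IsSmoothBoundaryPoint Ω p} =
      frontier Ω ∩ ⋃ p ∈ {p | IsSmoothBoundaryPoint Ω p}, V p := by
    ext y
    constructor
    · exact fun h => ⟨h.1,
        mem_biUnion (show y ∈ {p | IsSmoothBoundaryPoint Ω p} from h.2) (hpV y h.2)⟩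
    · rintro ⟨h1, h2⟩
      obtain ⟨p, hp, h3⟩ := mem_iUnion₂.1 h2
      exact ⟨h1, hVs p hp y ⟨h1, h3⟩⟩
  refine ⟨_, isOpen_biUnion fun p hp => hVo p hp, he, ?_⟩
  rintro y ⟨h1, h2⟩
  obtain ⟨p, hp, h3⟩ := mem_iUnion₂.1 h2
  refine ContinuousWithinAt.mono_of_mem_nhdsWithin (hVc p hp y ⟨h1, h3⟩) ?_
  exact inter_mem (mem_of_superset self_mem_nhdsWithin inter_subset_left)
    (nhdsWithin_le_nhds ((hVo p hp).mem_nhds h3))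

lemma isClosed_singular (hΩ : IsOpen Ω) :
    IsClosed {p ∈ frontier Ω | ¬ IsSmoothBoundaryPoint Ω p} := by
  obtain ⟨O, hO, he, -⟩ := exists_isOpen_smooth_eq hΩ
  have : {p ∈ frontier Ω | ¬ IsSmoothBoundaryPoint Ω p} = frontier Ω ∩ Oᶜ := by
    ext y
    have := congrArg (y ∈ ·) he
    simp only [mem_ofPred_eq, mem_inter_iff, eq_iff_iff, mem_compl_iff] at this ⊢
    tauto
  rw [this]
  exact isClosed_frontier.inter hO.isClosed_compl

lemma ae_smooth (hb : HasPiecewiseSmoothBoundary Ω) :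
    ∀ᵐ y ∂(surfaceMeasure n m).restrict (frontier Ω), IsSmoothBoundaryPoint Ω y := by
  rw [ae_restrict_iff' isClosed_frontier.measurableSet, ae_iff]
  convert hb.singular_null using 2
  ext y; simp

lemma aestronglyMeasurable_exteriorNormal (hΩ : IsOpen Ω) (hb : HasPiecewiseSmoothBoundary Ω) :
    AEStronglyMeasurable (exteriorNormal Ω) ((surfaceMeasure n m).restrict (frontier Ω)) := by
  obtain ⟨O, hO, he, hc⟩ := exists_isOpen_smooth_eq hΩ
  have hae : (frontier Ω ∩ O : Set (Space n m)) =ᵐ[surfaceMeasure n m] frontier Ω := by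
    rw [← he]
    refine (ae_eq_set.2 ⟨?_, ?_⟩)
    · rw [sdiff_eq_bot_iff.2 (fun y hy => hy.1)]; exact measure_empty
    · convert hb.singular_null using 2
      ext y; simp
  rw [← Measure.restrict_congr_set hae]
  exact hc.aestronglyMeasurable (isClosed_frontier.measurableSet.inter hO.measurableSet)

lemma isCompact_closure_of_isBounded (hbd : Bornology.IsBounded Ω) : IsCompact (closure Ω) :=
  Metric.isCompact_of_isClosed_isBounded isClosed_closure hbd.closure

/-- Continuous fields on the closure of `Ω` are integrable over the boundary. -/
lemma integrableOn_frontier {F : Type*} [NormedAddCommGroup F]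
    [SecondCountableTopology F] (hbd : Bornology.IsBounded Ω)
    (hb : HasPiecewiseSmoothBoundary Ω) {g : Space n m → F}
    (hg : ContinuousOn g (closure Ω)) : IntegrableOn g (frontier Ω) (surfaceMeasure n m) := by
  obtain ⟨C, hC⟩ := (isCompact_closure_of_isBounded hbd).exists_bound_of_continuousOn hg
  refine (integrableOn_const hb.area_lt_top.ne (C := C)).mono'
    ((hg.mono frontier_subset_closure).aestronglyMeasurable isClosed_frontier.measurableSet) ?_
  exact (ae_restrict_iff' isClosed_frontier.measurableSet).2
    (Eventually.of_forall fun y hy => hC y (frontier_subset_closure hy))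

lemma integrableOn_inner_exteriorNormal (hΩ : IsOpen Ω) (hbd : Bornology.IsBounded Ω)
    (hb : HasPiecewiseSmoothBoundary Ω) {Y : Space n m → Space n m}
    (hY : ContinuousOn Y (closure Ω)) :
    IntegrableOn (fun y => inner ℝ (exteriorNormal Ω y) (Y y)) (frontier Ω)
      (surfaceMeasure n m) := by
  refine (integrableOn_frontier hbd hb hY).norm.mono'
    ((aestronglyMeasurable_exteriorNormal hΩ hb).inner
      (integrableOn_frontier hbd hb hY).aestronglyMeasurable) (Eventually.of_forall fun y => ?_)
  exact (norm_inner_le_norm _ _).trans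
    (mul_le_of_le_one_left (norm_nonneg _) (norm_exteriorNormal_le _ _))

lemma divergence_sum {ι : Type*} (s : Finset ι) {Y : ι → Space n m → Space n m} {x : Space n m}
    (hY : ∀ i ∈ s, DifferentiableAt ℝ (Y i) x) :
    divergence (fun y => ∑ i ∈ s, Y i y) x = ∑ i ∈ s, divergence (Y i) x := by
  unfold divergence
  rw [Finset.sum_comm]
  refine Finset.sum_congr rfl fun j _ => ?_
  have h : (fun y => (∑ i ∈ s, Y i y) j) = fun y => ∑ i ∈ s, Y i y j := by ext y; simp
  rw [h, fderiv_fun_sum fun i hi => differentiableAt_euclidean.1 (hY i hi) j]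
  simp

/-- The divergence theorem up to a relative error `ε`, by a partition of unity, for fields which
vanish near the singular part of the boundary. -/
lemma abs_integral_divergence_sub_le_of_zero_near_singular (hΩ : IsOpen Ω)
    (hbd : Bornology.IsBounded Ω) (hb : HasPiecewiseSmoothBoundary Ω)
    {Y : Space n m → Space n m} (hY : ContinuousOn Y (closure Ω)) (hYd : ContDiffOn ℝ 1 Y Ω)
    (hint : IntegrableOn (divergence Y) Ω) {W : Set (Space n m)} (hW : IsOpen W)
    (hSW : {p ∈ frontier Ω | ¬ IsSmoothBoundaryPoint Ω p} ⊆ W) (hYW : ∀ y ∈ W, Y y = 0)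
    {ε : ℝ} (hε : 0 < ε) :
    |(∫ y in Ω, divergence Y y) -
        ∫ y in frontier Ω, inner ℝ (exteriorNormal Ω y) (Y y) ∂(surfaceMeasure n m)| ≤
      ε * ∫ y in frontier Ω, ‖Y y‖ ∂(surfaceMeasure n m) := by
  classical
  -- every point has a neighbourhood in which the estimate holds
  have hloc : ∀ q : Space n m, ∃ V : Set (Space n m), IsOpen V ∧ q ∈ V ∧
      ∀ (Z : Space n m → Space n m) (S : Set (Space n m)), ContinuousOn Z (closure Ω) →
        ContDiffOn ℝ 1 Z Ω → IsCompact S → S ⊆ V → (∀ y ∉ S, Z y = 0) → (∀ y ∈ W, Z y = 0) →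
        IntegrableOn (divergence Z) Ω →
        |(∫ y in Ω, divergence Z y) -
            ∫ y in frontier Ω, inner ℝ (exteriorNormal Ω y) (Z y) ∂(surfaceMeasure n m)| ≤
          ε * ∫ y in frontier Ω, ‖Z y‖ ∂(surfaceMeasure n m) := by
    intro q
    have hpos : ∀ Z : Space n m → Space n m,
        0 ≤ ε * ∫ y in frontier Ω, ‖Z y‖ ∂(surfaceMeasure n m) := fun Z =>
      mul_nonneg hε.le (integral_nonneg fun _ => norm_nonneg _)
    by_cases hqc : q ∈ closure Ω
    · by_cases hqΩ : q ∈ Ω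
      · refine ⟨Ω, hΩ, hqΩ, fun Z S hZ hZd hS hSΩ hZS _ _ => ?_⟩
        have hZ1 : ContDiff ℝ 1 Z := contDiff_iff_contDiffAt.2 fun y => by
          by_cases hy : y ∈ Ω
          · exact hZd.contDiffAt (hΩ.mem_nhds hy)
          · refine (contDiffAt_const (c := (0 : Space n m))).congr_of_eventuallyEq ?_
            filter_upwards [hS.isClosed.isOpen_compl.mem_nhds fun h => hy (hSΩ h)] with x hx
              using hZS x hx
        have h0 : ∫ y in Ω, divergence Z y = 0 := by
          rw [setIntegral_eq_integral_of_forall_compl_eq_zero,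
            integral_divergence_eq_zero hZ1 (HasCompactSupport.intro hS hZS)]
          intro y hy
          refine divergence_zero_of_eventuallyEq ?_
          filter_upwards [hS.isClosed.isOpen_compl.mem_nhds fun h => hy (hSΩ h)] with x hx
            using hZS x hx
        have h1 : ∫ y in frontier Ω,
            inner ℝ (exteriorNormal Ω y) (Z y) ∂(surfaceMeasure n m) = 0 := by
          refine setIntegral_eq_zero_of_forall_eq_zero fun y hy => ?_
          rw [hZS y, inner_zero_right]
          intro h
          rw [hΩ.frontier_eq] at hy
          exact hy.2 (hSΩ h)
        rw [h0, h1, sub_zero, abs_zero]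
        exact hpos Z
      · have hqf : q ∈ frontier Ω := by rw [hΩ.frontier_eq]; exact ⟨hqc, hqΩ⟩
        by_cases hqs : IsSmoothBoundaryPoint Ω q
        · obtain ⟨V, h1, h2, -, -, -, h3⟩ := exists_nhds_abs_integral_divergence_sub_le hΩ hqs hε
          exact ⟨V, h1, h2, fun Z S a b c d e _ f => h3 Z S a b c d e f⟩
        · refine ⟨W, hW, hSW ⟨hqf, hqs⟩, fun Z S _ _ _ hSW hZS hZW _ => ?_⟩
          have hZ0 : Z = fun _ => 0 := funext fun y => by
            by_cases h : y ∈ W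
            · exact hZW y h
            · exact hZS y fun h' => h (hSW h')
          subst hZ0
          simp [divergence]
    · refine ⟨(closure Ω)ᶜ, isClosed_closure.isOpen_compl, hqc, fun Z S _ _ hS hSΩ hZS _ _ => ?_⟩
      have hZ0 : ∀ y ∈ closure Ω, Z y = 0 := fun y hy => hZS y fun h => hSΩ h hy
      have h0 : ∫ y in Ω, divergence Z y = 0 :=
        setIntegral_eq_zero_of_forall_eq_zero fun y hy => divergence_zero_of_eventuallyEq (by
          filter_upwards [hΩ.mem_nhds hy] with x hx using hZ0 x (subset_closure hx))
      have h1 : ∫ y in frontier Ω, inner ℝ (exteriorNormal Ω y) (Z y) ∂(surfaceMeasure n m) = 0 :=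
        setIntegral_eq_zero_of_forall_eq_zero fun y hy => by
          rw [hZ0 y (frontier_subset_closure hy), inner_zero_right]
      rw [h0, h1, sub_zero, abs_zero]
      exact hpos Z
  choose V hVo hqV hV using hloc
  have hcomp := isCompact_closure_of_isBounded hbd
  obtain ⟨t, -, ht⟩ := hcomp.elim_nhds_subcover V fun q _ => (hVo q).mem_nhds (hqV q)
  obtain ⟨f, hf⟩ := SmoothPartitionOfUnity.exists_isSubordinate (modelWithCornersSelf ℝ (Space n m))
    (isClosed_closure (s := Ω)) (fun q : t => V q) (fun q => hVo q)
    (ht.trans (iUnion₂_subset fun q hq => subset_iUnion (fun q : t => V q) ⟨q, hq⟩))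
  have hfd : ∀ i, ContDiff ℝ 1 (f i) := fun i => ((f i).contMDiff.contDiff).of_le (by simp)
  have hsum : ∀ y ∈ closure Ω, ∑ i, f i y = 1 := fun y hy => by
    rw [← finsum_eq_sum_of_fintype]; exact f.sum_eq_one hy
  set Z : t → Space n m → Space n m := fun i =>
      (closure Ω).indicator fun y => f i y • Y y with hZdef
  have hZc : ∀ i, ∀ y ∈ closure Ω, Z i y = f i y • Y y := fun i y hy => indicator_of_mem hy _
  have hZ : ∀ i, ContinuousOn (Z i) (closure Ω) := fun i =>
    ((hfd i).continuous.continuousOn.smul hY).congr (hZc i)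
  have hZd : ∀ i, ContDiffOn ℝ 1 (Z i) Ω := fun i =>
    ((hfd i).contDiffOn.smul hYd).congr fun y hy => hZc i y (subset_closure hy)
  have hYdiff : ∀ y ∈ Ω, DifferentiableAt ℝ Y y := fun y hy =>
    (hYd.contDiffAt (hΩ.mem_nhds hy)).differentiableAt (by simp)
  have hdiv : ∀ i, ∀ y ∈ Ω, divergence (Z i) y =
      f i y * divergence Y y + fderiv ℝ (f i) y (Y y) := by
    intro i y hy
    rw [← divergence_smul ((hfd i).differentiable (by simp) y) (hYdiff y hy)]
    refine divergence_congr ?_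
    filter_upwards [hΩ.mem_nhds hy] with x hx using hZc i x (subset_closure hx)
  have hfin : volume Ω ≠ ⊤ := hbd.measure_lt_top.ne
  have hZint : ∀ i, IntegrableOn (divergence (Z i)) Ω := by
    intro i
    refine IntegrableOn.congr_fun ?_ (fun y hy => (hdiv i y hy).symm) hΩ.measurableSet
    refine Integrable.add ?_ ?_
    · refine hint.bdd_mul (c := 1) (hfd i).continuous.aestronglyMeasurable
        (Eventually.of_forall fun y => ?_)
      rw [Real.norm_of_nonneg (f.nonneg i y)]
      exact f.le_one i y
    · have hc : ContinuousOn (fun y => fderiv ℝ (f i) y (Y y)) (closure Ω) :=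
        ((hfd i).continuous_fderiv (by simp)).continuousOn.clm_apply hY
      exact (hc.integrableOn_compact hcomp).mono_set subset_closure
  have hest := fun i : t => hV i.1 (Z i) (tsupport (f i) ∩ closure Ω) (hZ i) (hZd i)
    (hcomp.inter_left (isClosed_tsupport _)) (inter_subset_left.trans (hf i))
    (fun y hy => by
      by_cases h : y ∈ closure Ω
      · rw [hZc i y h, image_eq_zero_of_notMem_tsupport fun h' => hy ⟨h', h⟩, zero_smul]
      · exact indicator_of_notMem h _)
    (fun y hy => by
      by_cases h : y ∈ closure Ω
      · rw [hZc i y h, hYW y hy, smul_zero]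
      · exact indicator_of_notMem h _) (hZint i)
  have s1 : ∫ y in Ω, divergence Y y = ∑ i, ∫ y in Ω, divergence (Z i) y := by
    rw [← integral_finsetSum _ fun i _ => hZint i]
    refine setIntegral_congr_fun hΩ.measurableSet fun y hy => ?_
    have hd : ∀ i ∈ Finset.univ, DifferentiableAt ℝ (Z i) y := fun i _ =>
      ((hZd i).contDiffAt (hΩ.mem_nhds hy)).differentiableAt (by simp)
    rw [← divergence_sum Finset.univ hd]
    refine divergence_congr ?_
    filter_upwards [hΩ.mem_nhds hy] with x hx
    have hx' := subset_closure hx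
    simp only [hZc _ x hx', ← Finset.sum_smul, hsum x hx', one_smul]
  have s2 : ∫ y in frontier Ω, inner ℝ (exteriorNormal Ω y) (Y y) ∂(surfaceMeasure n m) =
      ∑ i, ∫ y in frontier Ω, inner ℝ (exteriorNormal Ω y) (Z i y) ∂(surfaceMeasure n m) := by
    rw [← integral_finsetSum _ fun i _ => integrableOn_inner_exteriorNormal hΩ hbd hb (hZ i)]
    refine setIntegral_congr_fun isClosed_frontier.measurableSet fun y hy => ?_
    have hy' := frontier_subset_closure hy
    simp only [hZc _ y hy', ← inner_sum, ← Finset.sum_smul, hsum y hy', one_smul]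
  have s3 : ∫ y in frontier Ω, ‖Y y‖ ∂(surfaceMeasure n m) =
      ∑ i, ∫ y in frontier Ω, ‖Z i y‖ ∂(surfaceMeasure n m) := by
    rw [← integral_finsetSum _ fun i _ => (integrableOn_frontier hbd hb (hZ i)).norm]
    refine setIntegral_congr_fun isClosed_frontier.measurableSet fun y hy => ?_
    have hy' := frontier_subset_closure hy
    simp only [hZc _ y hy', norm_smul, Real.norm_of_nonneg (f.nonneg _ y), ← Finset.sum_mul,
      hsum y hy', one_mul]
  rw [s1, s2, s3, ← Finset.sum_sub_distrib, Finset.mul_sum]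
  exact (Finset.abs_sum_le_sum_abs _ _).trans (Finset.sum_le_sum fun i _ => hest i)

/-- The divergence theorem on a bounded open set with piecewise smooth boundary, for fields which
are continuous up to the boundary and `C¹` inside, with integrable divergence. -/
theorem integral_divergence_eq (hΩ : IsOpen Ω) (hbd : Bornology.IsBounded Ω)
    (hb : HasPiecewiseSmoothBoundary Ω) (hd : (m + 1) * n ≠ 0)
    {Y : Space n m → Space n m} (hY : ContinuousOn Y (closure Ω)) (hYd : ContDiffOn ℝ 1 Y Ω)
    (hint : IntegrableOn (divergence Y) Ω) :
    ∫ y in Ω, divergence Y y =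
      ∫ y in frontier Ω, inner ℝ (exteriorNormal Ω y) (Y y) ∂(surfaceMeasure n m) := by
  set S := {p ∈ frontier Ω | ¬ IsSmoothBoundaryPoint Ω p} with hSdef
  have hcomp := isCompact_closure_of_isBounded hbd
  have hS : IsCompact S := hcomp.of_isClosed_subset (isClosed_singular hΩ)
    fun y hy => frontier_subset_closure hy.1
  choose φ hφd hφ0 hφ1 hφW hφS hφi hφs using fun k : ℕ =>
    exists_cutoff hS hb.singular_null hd (Nat.one_div_pos_of_nat (α := ℝ) (n := k))
  have hYdiff : ∀ y ∈ Ω, DifferentiableAt ℝ Y y := fun y hy =>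
    (hYd.contDiffAt (hΩ.mem_nhds hy)).differentiableAt (by simp)
  have hdiv : ∀ k, ∀ y ∈ Ω, divergence (fun y => φ k y • Y y) y =
      φ k y * divergence Y y + fderiv ℝ (φ k) y (Y y) := fun k y hy =>
    divergence_smul ((hφd k).differentiable (by simp) y) (hYdiff y hy)
  have hnorm : ∀ k y, ‖φ k y‖ ≤ 1 := fun k y => by
    rw [Real.norm_of_nonneg (hφ0 k y)]; exact hφ1 k y
  have hi1 : ∀ k, IntegrableOn (fun y => φ k y * divergence Y y) Ω := fun k =>
    hint.bdd_mul (c := 1) (hφd k).continuous.aestronglyMeasurable (Eventually.of_forall (hnorm k))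
  have hi2 : ∀ k, IntegrableOn (fun y => fderiv ℝ (φ k) y (Y y)) Ω := fun k => by
    have hc : ContinuousOn (fun y => fderiv ℝ (φ k) y (Y y)) (closure Ω) :=
      ((hφd k).continuous_fderiv (by simp)).continuousOn.clm_apply hY
    exact (hc.integrableOn_compact hcomp).mono_set subset_closure
  have hi3 : ∀ k, IntegrableOn (divergence fun y => φ k y • Y y) Ω := fun k =>
    ((hi1 k).add (hi2 k)).congr_fun (fun y hy => (hdiv k y hy).symm) hΩ.measurableSet
  have hev : ∀ y ∉ S, ∀ᶠ k in atTop, φ k y = 1 := by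
    intro y hy
    obtain ⟨δ, hδ, hball⟩ := Metric.isOpen_iff.1 hS.isClosed.isOpen_compl y hy
    filter_upwards [tendsto_one_div_add_atTop_nhds_zero_nat.eventually (gt_mem_nhds hδ)] with k hk
    refine hφS k y fun x hx => ?_
    by_contra h
    refine hball (Metric.mem_ball'.2 ?_) hx
    push Not at h
    exact h.trans hk
  -- the theorem for the truncated fields
  have heq : ∀ k, (∫ y in Ω, φ k y * divergence Y y) + ∫ y in Ω, fderiv ℝ (φ k) y (Y y) =
      ∫ y in frontier Ω, φ k y * inner ℝ (exteriorNormal Ω y) (Y y) ∂(surfaceMeasure n m) := by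
    intro k
    obtain ⟨W, hWo, hSW, hW0⟩ := hφW k
    have h1 : ∀ ε > 0, |(∫ y in Ω, divergence (fun y => φ k y • Y y) y) -
        ∫ y in frontier Ω, inner ℝ (exteriorNormal Ω y) (φ k y • Y y) ∂(surfaceMeasure n m)| ≤
        ε * ∫ y in frontier Ω, ‖φ k y • Y y‖ ∂(surfaceMeasure n m) := fun ε hε =>
      abs_integral_divergence_sub_le_of_zero_near_singular (Y := fun y => φ k y • Y y) hΩ hbd hb
        ((hφd k).continuous.continuousOn.smul hY) ((hφd k).contDiffOn.smul hYd) (hi3 k) hWo hSW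
        (fun y hy => by rw [hW0 y hy, zero_smul]) hε
    have h2 : |(∫ y in Ω, divergence (fun y => φ k y • Y y) y) -
        ∫ y in frontier Ω, inner ℝ (exteriorNormal Ω y) (φ k y • Y y)
            ∂(surfaceMeasure n m)| ≤ 0 := by
      set I := ∫ y in frontier Ω, ‖φ k y • Y y‖ ∂(surfaceMeasure n m)
      have ht : Tendsto (fun ε : ℝ => ε * I) (𝓝[>] 0) (𝓝 0) := by
        have : Continuous fun ε : ℝ => ε * I := by fun_prop
        simpa using (this.tendsto 0).mono_left nhdsWithin_le_nhds
      exact ge_of_tendsto ht (by filter_upwards [self_mem_nhdsWithin] with ε hε using h1 ε hε)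
    have h3 := sub_eq_zero.1 (abs_nonpos_iff.1 h2)
    rw [setIntegral_congr_fun hΩ.measurableSet (hdiv k), integral_add (hi1 k) (hi2 k)] at h3
    simpa only [real_inner_smul_right] using h3
  have t1 : Tendsto (fun k => ∫ y in Ω, φ k y * divergence Y y) atTop
      (𝓝 (∫ y in Ω, divergence Y y)) := by
    refine tendsto_integral_of_dominated_convergence (fun y => ‖divergence Y y‖)
      (fun k => (hi1 k).aestronglyMeasurable) hint.norm
          (fun k => Eventually.of_forall fun y => ?_) ?_
    · rw [norm_mul]
      exact mul_le_of_le_one_left (norm_nonneg _) (hnorm k y)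
    · refine (ae_restrict_iff' hΩ.measurableSet).2 (Eventually.of_forall fun y hy => ?_)
      have hyS : y ∉ S := fun h => by
        have := h.1
        rw [hΩ.frontier_eq] at this
        exact this.2 hy
      refine tendsto_const_nhds.congr' ?_
      filter_upwards [hev y hyS] with k hk
      rw [hk, one_mul]
  have t2 : Tendsto (fun k => ∫ y in Ω, fderiv ℝ (φ k) y (Y y)) atTop (𝓝 0) := by
    obtain ⟨C, hC⟩ := hcomp.exists_bound_of_continuousOn hY
    have hC' : ∀ y ∈ Ω, ‖Y y‖ ≤ max C 0 := fun y hy =>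
      (hC y (subset_closure hy)).trans (le_max_left _ _)
    have hb2 : ∀ k, ‖∫ y in Ω, fderiv ℝ (φ k) y (Y y)‖ ≤ (1 / ((k : ℝ) + 1)) * max C 0 := by
      intro k
      calc ‖∫ y in Ω, fderiv ℝ (φ k) y (Y y)‖ ≤ ∫ y in Ω, ‖fderiv ℝ (φ k) y‖ * max C 0 := by
            refine norm_integral_le_of_norm_le ((hφi k).integrableOn.mul_const _) ?_
            refine (ae_restrict_iff' hΩ.measurableSet).2 (Eventually.of_forall fun y hy => ?_)
            exact (ContinuousLinearMap.le_opNorm _ _).trans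
              (mul_le_mul_of_nonneg_left (hC' y hy) (norm_nonneg _))
        _ = (∫ y in Ω, ‖fderiv ℝ (φ k) y‖) * max C 0 := integral_mul_const _ _
        _ ≤ (∫ y, ‖fderiv ℝ (φ k) y‖) * max C 0 := by
            refine mul_le_mul_of_nonneg_right ?_ (le_max_right _ _)
            exact setIntegral_le_integral (hφi k) (Eventually.of_forall fun _ => norm_nonneg _)
        _ ≤ _ := by gcongr; exact hφs k
    refine squeeze_zero_norm hb2 ?_
    simpa using (tendsto_one_div_add_atTop_nhds_zero_nat (𝕜 := ℝ)).mul_const (max C 0)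
  have hνi := integrableOn_inner_exteriorNormal hΩ hbd hb hY
  have t3 : Tendsto (fun k => ∫ y in frontier Ω, φ k y * inner ℝ (exteriorNormal Ω y) (Y y)
      ∂(surfaceMeasure n m)) atTop
      (𝓝 (∫ y in frontier Ω, inner ℝ (exteriorNormal Ω y) (Y y) ∂(surfaceMeasure n m))) := by
    refine tendsto_integral_of_dominated_convergence
      (fun y => ‖inner ℝ (exteriorNormal Ω y) (Y y)‖)
      (fun k => (hφd k).continuous.aestronglyMeasurable.mul hνi.aestronglyMeasurable) hνi.norm
      (fun k => Eventually.of_forall fun y => ?_) ?_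
    · rw [norm_mul]
      exact mul_le_of_le_one_left (norm_nonneg _) (hnorm k y)
    · filter_upwards [ae_smooth hb] with y hy
      refine tendsto_const_nhds.congr' ?_
      filter_upwards [hev y fun h => h.2 hy] with k hk
      rw [hk, one_mul]
  have t4 := t1.add t2
  rw [add_zero] at t4
  exact tendsto_nhds_unique t4 (t3.congr fun k => (heq k).symm)

end DivergenceTheorem

/-! ### The vector field of a monogenic function -/

section Monogenic

/-- The linearised left alternative law. -/
lemma mul_mul_add_mul_mul {A : Type*} [NonAssocRing A] [IsAlternative A] (a b c : A) :
    a * (b * c) + b * (a * c) = (a * b + b * a) * c := by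
  have h := IsAlternative.left_alternative (a + b) c
  have h1 := IsAlternative.left_alternative a c
  have h2 := IsAlternative.left_alternative b c
  simp only [add_mul, mul_add, h1, h2] at h ⊢
  rw [← sub_eq_zero] at h ⊢
  rw [← neg_eq_zero, ← h]
  abel

variable {A : Type*} [NonAssocRing A] [StarRing A] [Module ℝ A] {m d n : ℕ}

namespace HypercomplexBasis

variable (B : HypercomplexBasis A m d)

lemma v_zero : B.v 0 = 1 := B.apply_zero

lemma star_v {s : Fin (m + 1)} (hs : s ≠ 0) : star (B.v s) = -B.v s := by
  have h := (B.mem_sphere (Fin.castLE (Nat.succ_le_succ B.le) s)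
    (Nat.one_le_iff_ne_zero.2 fun h => hs (Fin.ext h)) (Nat.lt_succ_iff.1 s.2)).1
  exact eq_neg_of_add_eq_zero_right h

lemma v_mul_v {s : Fin (m + 1)} (hs : s ≠ 0) : B.v s * B.v s = -1 := by
  have h : B.v s * star (B.v s) = 1 := (B.mem_sphere (Fin.castLE (Nat.succ_le_succ B.le) s)
    (Nat.one_le_iff_ne_zero.2 fun h => hs (Fin.ext h)) (Nat.lt_succ_iff.1 s.2)).2
  rw [B.star_v hs, mul_neg] at h
  rw [← h, neg_neg]

lemma v_mul_v_anticomm {s t : Fin (m + 1)} (hs : s ≠ 0) (ht : t ≠ 0) (hst : s ≠ t) :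
    B.v s * B.v t = -(B.v t * B.v s) :=
  B.anticomm _ _ (Nat.one_le_iff_ne_zero.2 fun h => hs (Fin.ext h)) (Nat.lt_succ_iff.1 s.2)
    (Nat.one_le_iff_ne_zero.2 fun h => ht (Fin.ext h)) (Nat.lt_succ_iff.1 t.2)
    fun h => hst (by simpa [Fin.ext_iff] using h)

/-- The Clifford relations, as an identity of left multiplications. This is where alternativity
replaces associativity. -/
lemma star_v_mul_v_mul [IsAlternative A] (s t : Fin (m + 1)) (a : A) :
    star (B.v s) * (B.v t * a) + star (B.v t) * (B.v s * a) = if s = t then a + a else 0 := by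
  by_cases hs : s = 0
  · subst hs
    by_cases ht : t = 0
    · subst ht; simp [B.v_zero]
    · rw [if_neg (Ne.symm ht), B.star_v ht, B.v_zero]; simp
  · by_cases ht : t = 0
    · subst ht
      rw [if_neg hs, B.star_v hs, B.v_zero]; simp
    · rw [B.star_v hs, B.star_v ht, neg_mul, neg_mul, ← neg_add, mul_mul_add_mul_mul]
      split_ifs with h
      · subst h
        rw [B.v_mul_v hs, add_mul]; simp
      · rw [B.v_mul_v_anticomm hs ht h]; simp

/-- The structure constants `[v_sᶜ (v_{s'} v_τ)]_t`. -/
def coeff (t : Fin (d + 1)) (s s' : Fin (m + 1)) (τ : Fin (d + 1)) : ℝ :=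
  B.basis.repr (star (B.v s) * (B.v s' * B.basis τ)) t

lemma coeff_add_coeff [IsAlternative A] (t : Fin (d + 1)) (s s' : Fin (m + 1)) (τ : Fin (d + 1)) :
    B.coeff t s s' τ + B.coeff t s' s τ = if s = s' then (if τ = t then 2 else 0) else 0 := by
  rw [coeff, coeff, ← Finsupp.add_apply, ← map_add, B.star_v_mul_v_mul]
  split_ifs with h1 h2
  · subst h2; simp; norm_num
  · simp [h2]
  · simp

/-- The real vector field whose normal component on a surface is the `t`-th component of the
integrand, for a kernel with the real coefficients `W`. -/
def kernelField (W : Space n m → Space n m) (x : Space n m) (f : Space n m → A) (t : Fin (d + 1))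
    (y : Space n m) : Space n m :=
  WithLp.toLp 2 fun i => ∑ s' : Fin (m + 1), ∑ τ : Fin (d + 1),
    W (y - x) (i.1, s') * B.component f τ y * B.coeff t s' i.2 τ

lemma kernelField_apply (W : Space n m → Space n m) (x : Space n m) (f : Space n m → A)
    (t : Fin (d + 1)) (y : Space n m) (i : Fin n × Fin (m + 1)) :
    B.kernelField W x f t y i = ∑ s' : Fin (m + 1), ∑ τ : Fin (d + 1),
      W (y - x) (i.1, s') * B.component f τ y * B.coeff t s' i.2 τ := rfl

lemma continuousOn_kernelField {W : Space n m → Space n m} (hW : Continuous W) (x : Space n m)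
    {f : Space n m → A} {U : Set (Space n m)} (hf : ∀ τ, ContinuousOn (B.component f τ) U)
    (t : Fin (d + 1)) : ContinuousOn (B.kernelField W x f t) U := by
  refine (PiLp.continuous_toLp 2 _).comp_continuousOn (continuousOn_pi.2 fun i => ?_)
  refine continuousOn_finsetSum _ fun s' _ => continuousOn_finsetSum _ fun τ _ => ?_
  refine (ContinuousOn.mul ?_ (hf τ)).mul continuousOn_const
  exact Continuous.continuousOn (by fun_prop)

lemma contDiffOn_kernelField {W : Space n m → Space n m} (hW : ContDiff ℝ 1 W) (x : Space n m)
    {f : Space n m → A} {U : Set (Space n m)} (hf : ∀ τ, ContDiffOn ℝ 1 (B.component f τ) U)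
    (t : Fin (d + 1)) : ContDiffOn ℝ 1 (B.kernelField W x f t) U := by
  refine contDiffOn_euclidean.2 fun i => ?_
  simp only [kernelField_apply]
  refine ContDiffOn.sum fun s' _ => ContDiffOn.sum fun τ _ => ?_
  refine (ContDiffOn.mul ?_ (hf τ)).mul contDiffOn_const
  have : ContDiff ℝ 1 fun y => W y (i.1, s') := contDiff_euclidean.1 hW _
  exact (this.comp (contDiff_id.sub contDiff_const)).contDiffOn

/-- Monogenicity in terms of structure constants. -/
lemma sum_fderiv_mul_coeff_eq_zero [SMulCommClass ℝ A A] {f : Space n m → A}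
    {y : Space n m} {j : Fin n}
    (hf : B.dirac j f y = 0) (t : Fin (d + 1)) (s' : Fin (m + 1)) :
    ∑ s : Fin (m + 1), ∑ τ : Fin (d + 1),
      fderiv ℝ (B.component f τ) y (EuclideanSpace.single (j, s) 1) * B.coeff t s' s τ = 0 := by
  have h := congrArg (fun a => B.basis.repr (star (B.v s') * a) t) hf
  simpa [dirac, coeff, Finset.mul_sum, mul_smul_comm] using h

/-- If the Jacobian of `W` is symmetric, then the divergence of the field of a monogenic function is
`f_t div W`. -/
lemma divergence_kernelField [IsAlternative A] [SMulCommClass ℝ A A]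
    {W : Space n m → Space n m} (hW : Differentiable ℝ W)
    (hsymm : ∀ z a b, fderiv ℝ (fun y => W y a) z (EuclideanSpace.single b 1) =
      fderiv ℝ (fun y => W y b) z (EuclideanSpace.single a 1))
    (x : Space n m) {f : Space n m → A} {y : Space n m}
    (hfd : ∀ τ, DifferentiableAt ℝ (B.component f τ) y) (hf : ∀ j, B.dirac j f y = 0)
    (t : Fin (d + 1)) :
    divergence (B.kernelField W x f t) y = B.component f t y * divergence W (y - x) := by
  have hWd : ∀ a, HasFDerivAt (fun y => W (y - x) a) (fderiv ℝ (fun z => W z a) (y - x)) y := by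
    intro a
    have h1 : DifferentiableAt ℝ (fun z => W z a) (y - x) := differentiableAt_euclidean.1 (hW _) a
    exact h1.hasFDerivAt.comp y ((hasFDerivAt_id y).sub_const x)
  set D : Fin n → Fin (m + 1) → Fin (m + 1) → ℝ := fun j s' s =>
    fderiv ℝ (fun z => W z (j, s')) (y - x) (EuclideanSpace.single (j, s) 1) with hD
  have hfd1 : ∀ i : Fin n × Fin (m + 1), fderiv ℝ (fun y => B.kernelField W x f t y i) y
      (EuclideanSpace.single i 1) = ∑ s', ∑ τ, (D i.1 s' i.2 * B.component f τ y +
        W (y - x) (i.1, s') * fderiv ℝ (B.component f τ) y (EuclideanSpace.single i 1)) *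
          B.coeff t s' i.2 τ := by
    intro i
    simp only [kernelField_apply]
    have h2 : HasFDerivAt (fun y => ∑ s' : Fin (m + 1), ∑ τ : Fin (d + 1),
        W (y - x) (i.1, s') * B.component f τ y * B.coeff t s' i.2 τ)
        (∑ s' : Fin (m + 1), ∑ τ : Fin (d + 1), B.coeff t s' i.2 τ •
          (W (y - x) (i.1, s') • fderiv ℝ (B.component f τ) y +
            B.component f τ y • fderiv ℝ (fun z => W z (i.1, s')) (y - x))) y :=
      HasFDerivAt.fun_sum fun s' _ => HasFDerivAt.fun_sum fun τ _ =>
        ((hWd (i.1, s')).mul (hfd τ).hasFDerivAt).mul_const _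
    rw [h2.fderiv]
    simp only [sum_apply, smul_apply, add_apply, smul_eq_mul]
    refine Finset.sum_congr rfl fun s' _ => Finset.sum_congr rfl fun τ _ => ?_
    rw [hD]; ring
  have hDs : ∀ j s' s, D j s' s = D j s s' := fun j s' s => hsymm _ _ _
  unfold divergence
  simp only [hfd1, Fintype.sum_prod_type, Finset.mul_sum]
  refine Finset.sum_congr rfl fun j _ => ?_
  simp only [add_mul, Finset.sum_add_distrib]
  -- the derivatives of `f` cancel by monogenicity
  have z2 : ∑ s, ∑ s', ∑ τ, W (y - x) (j, s') *
      fderiv ℝ (B.component f τ) y (EuclideanSpace.single (j, s) 1) * B.coeff t s' s τ = 0 := by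
    rw [Finset.sum_comm]
    refine Finset.sum_eq_zero fun s' _ => ?_
    have := B.sum_fderiv_mul_coeff_eq_zero (hf j) t s'
    simp only [mul_assoc, ← Finset.mul_sum, this, mul_zero]
  -- the derivatives of `W` are symmetrised
  have z1 : 2 * ∑ s, ∑ s', ∑ τ, D j s' s * B.component f τ y * B.coeff t s' s τ =
      2 * ∑ s, B.component f t y * D j s s := by
    have e1 : ∑ s, ∑ s', ∑ τ, D j s' s * B.component f τ y * B.coeff t s' s τ =
        ∑ s, ∑ s', ∑ τ, D j s' s * B.component f τ y * B.coeff t s s' τ := by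
      rw [Finset.sum_comm]
      refine Finset.sum_congr rfl fun s _ => Finset.sum_congr rfl fun s' _ =>
        Finset.sum_congr rfl fun τ _ => ?_
      rw [hDs]
    have e2 : ∑ s, ∑ s', ∑ τ, D j s' s * B.component f τ y * B.coeff t s' s τ +
        ∑ s, ∑ s', ∑ τ, D j s' s * B.component f τ y * B.coeff t s s' τ =
        ∑ s, ∑ s', ∑ τ, D j s' s * B.component f τ y *
          (if s' = s then (if τ = t then 2 else 0) else 0) := by
      simp only [← Finset.sum_add_distrib, ← mul_add, B.coeff_add_coeff]
    rw [two_mul]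
    nth_rewrite 2 [e1]
    rw [e2]
    simp [Finset.mul_sum, mul_comm]
  rw [z2, add_zero]
  exact mul_left_cancel₀ two_ne_zero z1

/-- The normal component of the field is the `t`-th component of the integrand. -/
lemma inner_kernelField [IsScalarTower ℝ A A] [SMulCommClass ℝ A A] [StarModule ℝ A]
    (W : Space n m → Space n m) (x : Space n m) (f : Space n m → A)
    (t : Fin (d + 1)) (y ν : Space n m) :
    inner ℝ ν (B.kernelField W x f t y) =
      B.basis.repr (∑ j, star (B.coord (W (y - x)) j) * (B.coord ν j * f y)) t := by
  have hfy : f y = ∑ τ, B.component f τ y • B.basis τ := (B.basis.sum_repr (f y)).symm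
  rw [hfy]
  simp only [coord, star_sum, star_smul, star_trivial, Finset.sum_mul, Finset.mul_sum,
    smul_mul_assoc, mul_smul_comm, map_sum, map_smul, Finsupp.coe_finsetSum, Finset.sum_apply,
    Finsupp.smul_apply, smul_eq_mul, PiLp.inner_apply, Fintype.sum_prod_type, kernelField_apply]
  refine Finset.sum_congr rfl fun j _ => ?_
  simp only [RCLike.inner_apply, conj_trivial, Finset.sum_mul, coeff]
  conv_rhs => rw [Finset.sum_comm]
  refine Finset.sum_congr rfl fun s _ => ?_
  rw [Finset.sum_comm]
  refine Finset.sum_congr rfl fun τ _ => Finset.sum_congr rfl fun s' _ => ?_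
  ring

end HypercomplexBasis
end Monogenic

/-! ### The unit ball -/

section Ball

variable {n m : ℕ}

lemma gradient_norm_sq_sub (p : Space n m) :
    HasGradientAt (fun y : Space n m => ‖y‖ ^ 2 - 1) ((2 : ℝ) • p) p := by
  rw [hasGradientAt_iff_hasFDerivAt]
  have := ((hasStrictFDerivAt_norm_sq p).hasFDerivAt).sub_const (1 : ℝ)
  exact this.congr_fderiv (by ext v; simp)

lemma isDefiningFunctionAt_ball {p : Space n m} (hp : ‖p‖ = 1) :
    IsDefiningFunctionAt (Metric.ball 0 1) (fun y : Space n m => ‖y‖ ^ 2 - 1) p where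
  contDiffAt := ((contDiff_norm_sq ℝ).sub contDiff_const).contDiffAt
  apply_eq_zero := by simp [hp]
  gradient_ne_zero := by
    rw [(gradient_norm_sq_sub p).gradient]
    refine smul_ne_zero two_ne_zero ?_
    rintro rfl
    simp at hp
  mem_iff := Eventually.of_forall fun y => by
    rw [mem_ball_zero_iff, sub_neg, sq_lt_one_iff₀ (norm_nonneg y)]

lemma isExteriorUnitNormal_ball {p : Space n m} (hp : ‖p‖ = 1) :
    IsExteriorUnitNormal (Metric.ball 0 1) p p := by
  refine ⟨_, isDefiningFunctionAt_ball hp, ?_⟩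
  rw [(gradient_norm_sq_sub p).gradient, norm_smul, hp, smul_smul]
  simp

lemma exteriorNormal_ball {p : Space n m} (hp : ‖p‖ = 1) :
    exteriorNormal (Metric.ball 0 1) p = p :=
  (exteriorNormal_spec ⟨p, isExteriorUnitNormal_ball hp⟩).unique (isExteriorUnitNormal_ball hp)

lemma norm_of_mem_frontier_ball {p : Space n m} (hp : p ∈ frontier (Metric.ball 0 1)) :
    ‖p‖ = 1 := by
  rw [frontier_ball _ one_ne_zero] at hp
  simpa using hp

lemma hasPiecewiseSmoothBoundary_ball :
    HasPiecewiseSmoothBoundary (Metric.ball (0 : Space n m) 1) where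
  area_lt_top := by
    have hc : IsCompact (frontier (Metric.ball (0 : Space n m) 1)) := by
      rw [frontier_ball _ one_ne_zero]; exact isCompact_sphere _ _
    refine hc.measure_lt_top_of_nhdsWithin fun p hp => ?_
    obtain ⟨V, hVo, hpV, hfin, -⟩ := exists_nhds_abs_integral_divergence_sub_le Metric.isOpen_ball
      ⟨p, isExteriorUnitNormal_ball (norm_of_mem_frontier_ball hp)⟩ one_pos
    exact ⟨_, inter_mem self_mem_nhdsWithin (nhdsWithin_le_nhds (hVo.mem_nhds hpV)), hfin⟩
  singular_null := by
    convert measure_empty (μ := surfaceMeasure n m)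
    refine eq_empty_of_forall_notMem fun p hp => hp.2 ?_
    exact ⟨p, isExteriorUnitNormal_ball (norm_of_mem_frontier_ball hp.1)⟩

/-- The divergence theorem on the unit ball, for fields which agree with the normal on the
unit sphere. -/
lemma integral_divergence_ball (hd : (m + 1) * n ≠ 0) {Y : Space n m → Space n m}
    (hY : ContDiff ℝ 1 Y) (hY1 : ∀ y, ‖y‖ = 1 → Y y = y) :
    ∫ y in Metric.ball 0 1, divergence Y y =
      (surfaceMeasure n m).real (Metric.sphere 0 1) := by
  have hc : Continuous (divergence Y) := by
    rw [← continuousOn_univ]; exact continuousOn_divergence isOpen_univ hY.contDiffOn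
  have hint : IntegrableOn (divergence Y) (Metric.ball 0 1) :=
    (hc.continuousOn.integrableOn_compact (isCompact_closedBall (0 : Space n m) 1)).mono_set
      Metric.ball_subset_closedBall
  rw [integral_divergence_eq Metric.isOpen_ball Metric.isBounded_ball
    hasPiecewiseSmoothBoundary_ball hd hY.continuous.continuousOn hY.contDiffOn hint]
  have h1 : ∀ y ∈ frontier (Metric.ball (0 : Space n m) 1),
      inner ℝ (exteriorNormal (Metric.ball 0 1) y) (Y y) = (1 : ℝ) := by
    intro y hy
    have hy1 := norm_of_mem_frontier_ball hy
    rw [exteriorNormal_ball hy1, hY1 y hy1, real_inner_self_eq_norm_sq, hy1, one_pow]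
  rw [setIntegral_congr_fun isClosed_frontier.measurableSet h1, frontier_ball _ one_ne_zero,
    setIntegral_const, smul_eq_mul, mul_one]

/-- The unit sphere has positive area. -/
lemma surfaceMeasure_sphere_pos (hd : (m + 1) * n ≠ 0) :
    0 < (surfaceMeasure n m).real (Metric.sphere 0 1) := by
  rw [← integral_divergence_ball hd contDiff_id (fun _ _ => rfl)]
  have h1 : ∀ y : Space n m, divergence id y = (m + 1) * n := by
    intro y
    have h2 : ∀ i, fderiv ℝ (fun y : Space n m => (id y) i) y (EuclideanSpace.single i 1) = 1 := by
      intro i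
      have : HasFDerivAt (fun y : Space n m => (id y) i)
          (EuclideanSpace.proj i : Space n m →L[ℝ] ℝ) y :=
        (EuclideanSpace.proj i : Space n m →L[ℝ] ℝ).hasFDerivAt
      rw [this.fderiv]; simp
    simp only [divergence, h2]
    simp [mul_comm]
  simp_rw [h1]
  rw [setIntegral_const, smul_eq_mul]
  refine mul_pos (ENNReal.toReal_pos (Metric.measure_ball_pos _ _ one_pos).ne'
    measure_ball_lt_top.ne) ?_
  exact_mod_cast Nat.pos_of_ne_zero hd

end Ball

/-! ### The radial kernel, cut off at the pole -/

section Radial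

/-- The profile `s ↦ s^{-N/2}`, cut off near `s = 0` at the scale `r²`. -/
def profile (N : ℕ) (r s : ℝ) : ℝ := transition (s / r ^ 2) * s ^ (-(N / 2 : ℝ))

variable {N : ℕ} {r : ℝ}

lemma profile_of_ge (hr : 0 < r) {s : ℝ} (hs : 2 * r ^ 2 ≤ s) :
    profile N r s = s ^ (-(N / 2 : ℝ)) := by
  rw [profile, transition_of_ge, one_mul]
  rwa [le_div_iff₀ (by positivity)]

lemma profile_eventuallyEq_zero (hr : 0 < r) {s : ℝ} (hs : s < r ^ 2) :
    profile N r =ᶠ[𝓝 s] fun _ => 0 := by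
  filter_upwards [Iio_mem_nhds hs] with x hx
  rw [profile, transition_of_le, zero_mul]
  rw [div_le_one (by positivity)]
  exact le_of_lt hx

lemma contDiff_profile (hr : 0 < r) : ContDiff ℝ 1 (profile N r) := by
  rw [contDiff_iff_contDiffAt]
  intro s
  rcases lt_or_ge s (r ^ 2) with h | h
  · exact contDiffAt_const.congr_of_eventuallyEq (profile_eventuallyEq_zero hr h)
  · have hs : s ≠ 0 := (lt_of_lt_of_le (by positivity) h).ne'
    refine ContDiffAt.mul ?_ (Real.contDiffAt_rpow_const_of_ne hs)
    exact ((contDiff_transition (k := 1)).comp (contDiff_id.div_const _)).contDiffAt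

/-- `div (B(|y|²) y) = N B(s) + 2 B'(s) s` with `s = |y|²`: the power `s^{-N/2}` drops out and only
the derivative of the cutoff remains. -/
lemma mul_profile_add (hr : 0 < r) (s : ℝ) :
    N * profile N r s + 2 * deriv (profile N r) s * s =
      2 * (deriv transition (s / r ^ 2) / r ^ 2) * s ^ (-(N / 2 : ℝ)) * s := by
  rcases lt_or_ge s (r ^ 2) with h | h
  · have h0 := profile_eventuallyEq_zero (N := N) hr h
    rw [h0.deriv_eq, deriv_const, h0.eq_of_nhds, deriv_transition_of_lt]
    · simp
    · rwa [div_lt_one (by positivity)]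
  · have hs : 0 < s := lt_of_lt_of_le (by positivity) h
    have h1 : HasDerivAt (fun s => transition (s / r ^ 2))
        (deriv transition (s / r ^ 2) * (1 / r ^ 2))
        s := (hasDerivAt_transition _).comp s ((hasDerivAt_id s).div_const _)
    have h2 : HasDerivAt (fun s : ℝ => s ^ (-(N / 2 : ℝ)))
        (-(N / 2 : ℝ) * s ^ (-(N / 2 : ℝ) - 1)) s :=
      Real.hasDerivAt_rpow_const (Or.inl hs.ne')
    have h3 : HasDerivAt (profile N r) _ s := h1.mul h2
    rw [h3.deriv, profile, Real.rpow_sub_one hs.ne']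
    field_simp
    ring

variable {n m : ℕ}

/-- The vector field `y / |y|^N`, `N = (m+1)n`, cut off near the origin at the scale `r`. -/
def cutoffKernel (n m : ℕ) (r : ℝ) (y : Space n m) : Space n m :=
  profile ((m + 1) * n) r (‖y‖ ^ 2) • y

lemma contDiff_cutoffKernel (hr : 0 < r) : ContDiff ℝ 1 (cutoffKernel n m r) :=
  ((contDiff_profile hr).comp (contDiff_norm_sq ℝ)).smul contDiff_id

lemma cutoffKernel_of_ge (hr : 0 < r) {y : Space n m} (hy : 2 * r ^ 2 ≤ ‖y‖ ^ 2) :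
    cutoffKernel n m r y = (‖y‖ ^ ((m + 1) * n))⁻¹ • y := by
  rw [cutoffKernel, profile_of_ge hr hy, Real.rpow_neg (by positivity), ← Real.rpow_natCast ‖y‖ 2,
    ← Real.rpow_mul (norm_nonneg y), ← Real.rpow_natCast ‖y‖ ((m + 1) * n)]
  congr 3
  push_cast
  ring

lemma fderiv_cutoffKernel_apply (hr : 0 < r) (z : Space n m) (a : Fin n × Fin (m + 1))
    (v : Space n m) :
    fderiv ℝ (fun y => cutoffKernel n m r y a) z v =
      profile ((m + 1) * n) r (‖z‖ ^ 2) * v a +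
        2 * deriv (profile ((m + 1) * n) r) (‖z‖ ^ 2) * inner ℝ z v * z a := by
  have h1 : HasDerivAt (profile ((m + 1) * n) r) (deriv (profile ((m + 1) * n) r) (‖z‖ ^ 2))
      (‖z‖ ^ 2) := ((contDiff_profile hr).differentiable (by simp) _).hasDerivAt
  have h2 := h1.comp_hasFDerivAt z (hasStrictFDerivAt_norm_sq z).hasFDerivAt
  have h3 : HasFDerivAt (fun y : Space n m => y a) (EuclideanSpace.proj a : Space n m →L[ℝ] ℝ) z :=
    (EuclideanSpace.proj a : Space n m →L[ℝ] ℝ).hasFDerivAt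
  have h4 : HasFDerivAt (fun y => cutoffKernel n m r y a) _ z := h2.mul h3
  rw [h4.fderiv]
  simp
  ring

lemma fderiv_cutoffKernel_symm (hr : 0 < r) (z : Space n m) (a b : Fin n × Fin (m + 1)) :
    fderiv ℝ (fun y => cutoffKernel n m r y a) z (EuclideanSpace.single b 1) =
      fderiv ℝ (fun y => cutoffKernel n m r y b) z (EuclideanSpace.single a 1) := by
  rw [fderiv_cutoffKernel_apply hr, fderiv_cutoffKernel_apply hr]
  simp only [EuclideanSpace.inner_single_right, PiLp.single_apply, conj_trivial,
      one_mul, eq_comm (a := a)]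
  ring

lemma divergence_cutoffKernel (hr : 0 < r) (z : Space n m) :
    divergence (cutoffKernel n m r) z =
      2 * (deriv transition (‖z‖ ^ 2 / r ^ 2) / r ^ 2) *
        (‖z‖ ^ 2) ^ (-(((m + 1) * n : ℕ) / 2 : ℝ)) * ‖z‖ ^ 2 := by
  rw [← mul_profile_add hr, divergence]
  simp only [fderiv_cutoffKernel_apply hr]
  rw [Finset.sum_add_distrib]
  congr 1
  · simp [mul_comm]
  · rw [EuclideanSpace.norm_sq_eq, Finset.mul_sum]
    refine Finset.sum_congr rfl fun i _ => ?_
    simp [EuclideanSpace.inner_single_right]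
    ring

lemma divergence_cutoffKernel_nonneg (hr : 0 < r) (z : Space n m) :
    0 ≤ divergence (cutoffKernel n m r) z := by
  rw [divergence_cutoffKernel hr]
  have := deriv_transition_nonneg (‖z‖ ^ 2 / r ^ 2)
  positivity

lemma divergence_cutoffKernel_of_gt (hr : 0 < r) {z : Space n m} (hz : 2 * r ^ 2 < ‖z‖ ^ 2) :
    divergence (cutoffKernel n m r) z = 0 := by
  rw [divergence_cutoffKernel hr, deriv_transition_of_gt]
  · simp
  · rwa [lt_div_iff₀ (by positivity)]

lemma continuous_divergence_cutoffKernel (hr : 0 < r) :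
    Continuous (divergence (cutoffKernel n m r)) := by
  rw [← continuousOn_univ]
  exact continuousOn_divergence isOpen_univ (contDiff_cutoffKernel hr).contDiffOn

lemma integrable_divergence_cutoffKernel (hr : 0 < r) :
    Integrable (divergence (cutoffKernel n m r)) := by
  refine (continuous_divergence_cutoffKernel hr).integrable_of_hasCompactSupport
    (HasCompactSupport.intro (isCompact_closedBall 0 (2 * r)) fun z hz => ?_)
  refine divergence_cutoffKernel_of_gt hr ?_
  have : 2 * r < ‖z‖ := by simpa using hz
  nlinarith

/-- The total mass of `div (y/|y|^N)`, a multiple of the Dirac mass at the origin, is the area of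
the unit sphere. -/
lemma integral_divergence_cutoffKernel (hd : (m + 1) * n ≠ 0) (hr : 0 < r) (hr1 : 2 * r ^ 2 < 1) :
    ∫ z, divergence (cutoffKernel n m r) z = (surfaceMeasure n m).real (Metric.sphere 0 1) := by
  rw [← integral_divergence_ball hd (contDiff_cutoffKernel hr),
    setIntegral_eq_integral_of_forall_compl_eq_zero]
  · intro z hz
    refine divergence_cutoffKernel_of_gt hr (hr1.trans_le ?_)
    have : 1 ≤ ‖z‖ := by simpa using hz
    nlinarith
  · intro y hy
    rw [cutoffKernel_of_ge hr (by rw [hy]; linarith), hy]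
    simp

end Radial

/-! ### The integral formula -/

section BochnerMartinelliFormula

variable {A : Type*} [NonAssocRing A] [StarRing A] [Module ℝ A] {m d n : ℕ}

namespace HypercomplexBasis

variable (B : HypercomplexBasis A m d)

lemma coord_smul (c : ℝ) (z : Space n m) (j : Fin n) : B.coord (c • z) j = c • B.coord z j := by
  simp [coord, Finset.smul_sum, smul_smul]

lemma kernel_eq_cutoffKernel [StarModule ℝ A] {r : ℝ} (hr : 0 < r) (j : Fin n) {z : Space n m}
    (hz : 2 * r ^ 2 ≤ ‖z‖ ^ 2) :
    B.kernel j z = ((surfaceMeasure n m).real (Metric.sphere 0 1))⁻¹ •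
      star (B.coord (cutoffKernel n m r z) j) := by
  rw [cutoffKernel_of_ge hr hz, coord_smul, star_smul, star_trivial, smul_smul, kernel, mul_inv]

variable [IsScalarTower ℝ A A] [SMulCommClass ℝ A A] [StarModule ℝ A]

/-- Away from the pole, the integrand is the normal component of a vector field. -/
lemma component_kernelStar {r : ℝ} (hr : 0 < r) (Ω : Set (Space n m)) (f : Space n m → A)
    (t : Fin (d + 1)) {x y : Space n m} (hxy : 2 * r ^ 2 ≤ ‖y - x‖ ^ 2) :
    B.component (B.kernelStar Ω f x) t y =
      ((surfaceMeasure n m).real (Metric.sphere 0 1))⁻¹ *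
        inner ℝ (exteriorNormal Ω y) (B.kernelField (cutoffKernel n m r) x f t y) := by
  rw [inner_kernelField, component, kernelStar]
  simp only [B.kernel_eq_cutoffKernel hr _ hxy, smul_mul_assoc, ← Finset.smul_sum, map_smul,
    Finsupp.smul_apply, smul_eq_mul]

variable [IsAlternative A] {Ω : Set (Space n m)} {f : Space n m → A}

/-- The integrand is integrable, and its integral is a volume average of `f` near the pole. -/
lemma integrableOn_and_integral_kernelStar (hn : (m + 1) * n ≠ 0)
    (hΩ : IsPiecewiseSmoothDomain Ω) (hf : B.LeftMonogenicOnClosure f Ω) {r : ℝ} (hr : 0 < r)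
    {x : Space n m} (hx : ∀ y ∈ frontier Ω, 2 * r ^ 2 ≤ ‖y - x‖ ^ 2) (t : Fin (d + 1)) :
    IntegrableOn (B.component (B.kernelStar Ω f x) t) (frontier Ω) (surfaceMeasure n m) ∧
    ∫ y in frontier Ω, B.component (B.kernelStar Ω f x) t y ∂(surfaceMeasure n m) =
      ((surfaceMeasure n m).real (Metric.sphere 0 1))⁻¹ *
        ∫ y in Ω, B.component f t y * divergence (cutoffKernel n m r) (y - x) := by
  set W := cutoffKernel n m r
  have hWd : ContDiff ℝ 1 W := contDiff_cutoffKernel hr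
  have hY := B.continuousOn_kernelField hWd.continuous x hf.continuousOn t
  have hYd := B.contDiffOn_kernelField hWd x hf.leftMonogenicOn.contDiffOn t
  have heq : ∀ y ∈ frontier Ω, B.component (B.kernelStar Ω f x) t y = _ := fun y hy =>
    B.component_kernelStar hr Ω f t (hx y hy)
  have hdiv : ∀ y ∈ Ω, divergence (B.kernelField W x f t) y =
      B.component f t y * divergence W (y - x) := fun y hy =>
    B.divergence_kernelField (hWd.differentiable (by simp)) (fderiv_cutoffKernel_symm hr) x
      (fun τ => ((hf.leftMonogenicOn.contDiffOn τ).contDiffAt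
        (hΩ.isOpen.mem_nhds hy)).differentiableAt (by simp))
      (hf.leftMonogenicOn.dirac_eq_zero y hy) t
  have hcomp := isCompact_closure_of_isBounded hΩ.isBounded
  have hint : IntegrableOn (divergence (B.kernelField W x f t)) Ω := by
    refine IntegrableOn.congr_fun ?_ (fun y hy => (hdiv y hy).symm) hΩ.isOpen.measurableSet
    refine IntegrableOn.mono_set (ContinuousOn.integrableOn_compact hcomp ?_) subset_closure
    exact (hf.continuousOn t).mul ((continuous_divergence_cutoffKernel hr).comp
      (continuous_id.sub continuous_const)).continuousOn
  have hνi := integrableOn_inner_exteriorNormal hΩ.isOpen hΩ.isBounded hΩ.boundary hY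
  constructor
  · exact IntegrableOn.congr_fun (hνi.const_mul _) (fun y hy => (heq y hy).symm)
      isClosed_frontier.measurableSet
  · rw [setIntegral_congr_fun isClosed_frontier.measurableSet heq, integral_const_mul,
      ← integral_divergence_eq hΩ.isOpen hΩ.isBounded hΩ.boundary hn hY hYd hint,
      setIntegral_congr_fun hΩ.isOpen.measurableSet hdiv]

end HypercomplexBasis

/-- The cut off divergences form an approximate identity at `x`, up to the area of the sphere. -/
lemma abs_integral_mul_divergence_cutoffKernel_sub_le (hd : (m + 1) * n ≠ 0) {r : ℝ} (hr : 0 < r)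
    (hr1 : 2 * r ^ 2 < 1) {Ω : Set (Space n m)} {x : Space n m}
    {g : Space n m → ℝ} {ε : ℝ} (hg : ∀ y, ‖y - x‖ ≤ 2 * r → y ∈ Ω ∧ |g y - g x| ≤ ε)
    (hi : IntegrableOn (fun y => g y * divergence (cutoffKernel n m r) (y - x)) Ω) :
    |(∫ y in Ω, g y * divergence (cutoffKernel n m r) (y - x)) -
      (surfaceMeasure n m).real (Metric.sphere 0 1) * g x| ≤
      ε * (surfaceMeasure n m).real (Metric.sphere 0 1) := by
  set κ : Space n m → ℝ := fun y => divergence (cutoffKernel n m r) (y - x) with hκ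
  set σ := (surfaceMeasure n m).real (Metric.sphere 0 1)
  have hκ0 : ∀ y, ¬ ‖y - x‖ ≤ 2 * r → κ y = 0 := fun y hy =>
    divergence_cutoffKernel_of_gt hr (by push Not at hy; nlinarith)
  have hκΩ : ∀ y ∉ Ω, κ y = 0 := fun y hy => hκ0 y fun h => hy (hg y h).1
  have hκi : Integrable κ := (integrable_divergence_cutoffKernel hr).comp_sub_right x
  have hκσ : ∫ y, κ y = σ :=
    (integral_sub_right_eq_self (divergence (cutoffKernel n m r)) x).trans
      (integral_divergence_cutoffKernel hd hr hr1)
  have hκσΩ : ∫ y in Ω, κ y = σ := by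
    rw [setIntegral_eq_integral_of_forall_compl_eq_zero hκΩ, hκσ]
  have h1 : (∫ y in Ω, g y * κ y) - σ * g x = ∫ y in Ω, (g y - g x) * κ y := by
    rw [← hκσΩ, ← integral_mul_const, ← integral_sub hi (hκi.integrableOn.mul_const _)]
    congr 1; ext y; ring
  rw [h1, ← hκσΩ, ← integral_const_mul, ← Real.norm_eq_abs]
  refine norm_integral_le_of_norm_le (hκi.integrableOn.const_mul ε)
    (Eventually.of_forall fun y => ?_)
  rw [norm_mul, Real.norm_eq_abs, Real.norm_of_nonneg (divergence_cutoffKernel_nonneg hr _)]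
  by_cases hy : ‖y - x‖ ≤ 2 * r
  · exact mul_le_mul_of_nonneg_right (hg y hy).2 (divergence_cutoffKernel_nonneg hr _)
  · rw [show divergence (cutoffKernel n m r) (y - x) = 0 from hκ0 y hy, mul_zero,
      hκ0 y hy, mul_zero]

end BochnerMartinelliFormula

end BochnerMartinelli

end

open BochnerMartinelli in
theorem mainTheorem2 {A : Type*} [NonAssocRing A] [StarRing A] [Module ℝ A]
    [IsScalarTower ℝ A A] [SMulCommClass ℝ A A] [StarModule ℝ A]
    [BochnerMartinelli.IsAlternative A] {m d n : ℕ}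
    (B : BochnerMartinelli.HypercomplexBasis A m d) (hn : 1 ≤ n)
    (Ω : Set (BochnerMartinelli.Space n m))
    (hΩ : BochnerMartinelli.IsPiecewiseSmoothDomain Ω)
    (f : BochnerMartinelli.Space n m → A) (hf : B.LeftMonogenicOnClosure f Ω) :
    (∀ x ∈ Ω, B.SurfaceIntegrable (frontier Ω) (B.kernelStar Ω f x) ∧
      B.surfaceIntegral (frontier Ω) (B.kernelStar Ω f x) = f x) ∧
    (∀ x ∈ (closure Ω)ᶜ, B.SurfaceIntegrable (frontier Ω) (B.kernelStar Ω f x) ∧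
      B.surfaceIntegral (frontier Ω) (B.kernelStar Ω f x) = 0) := by
  have hd : (m + 1) * n ≠ 0 := (Nat.mul_pos m.succ_pos hn).ne'
  set σ := (surfaceMeasure n m).real (Metric.sphere 0 1) with hσ
  have hσ0 : 0 < σ := surfaceMeasure_sphere_pos hd
  -- a ball around a point off the boundary gives admissible scales
  have hsq : ∀ {δ r : ℝ}, 0 < δ → 0 < r → r ≤ δ / 2 → ∀ {S : Set (Space n m)} {x : Space n m},
      Metric.ball x δ ⊆ Sᶜ → ∀ y ∈ S, 2 * r ^ 2 < ‖y - x‖ ^ 2 := by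
    intro δ r hδ hr hrδ S x hb y hy
    have h1 : δ ≤ ‖y - x‖ := by
      by_contra h
      exact hb (by rw [Metric.mem_ball, dist_eq_norm]; exact not_le.1 h) hy
    nlinarith
  constructor
  · intro x hx
    have hxf : Ω ⊆ (frontier Ω)ᶜ := fun y hy h => by
      rw [hΩ.isOpen.frontier_eq] at h
      exact h.2 hy
    obtain ⟨δ, hδ, hball⟩ := Metric.isOpen_iff.1 hΩ.isOpen x hx
    have hmain := fun r (hr : 0 < r) (hrδ : r ≤ δ / 2) =>
      B.integrableOn_and_integral_kernelStar hd hΩ hf hr fun y hy =>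
        (hsq hδ hr hrδ (hball.trans hxf) y hy).le
    refine ⟨fun t => (hmain (δ / 2) (half_pos hδ) le_rfl t).1, ?_⟩
    have hcomp : ∀ t, ∫ y in frontier Ω, B.component (B.kernelStar Ω f x) t y
        ∂(surfaceMeasure n m) = B.component f t x := by
      intro t
      set I := ∫ y in frontier Ω, B.component (B.kernelStar Ω f x) t y ∂(surfaceMeasure n m)
      refine eq_of_forall_dist_le fun ε hε => ?_
      have hca : ContinuousAt (B.component f t) x :=
        (hf.leftMonogenicOn.contDiffOn t).continuousOn.continuousAt (hΩ.isOpen.mem_nhds hx)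
      obtain ⟨η, hη, hηε⟩ := Metric.continuousAt_iff.1 hca ε hε
      set r := min (min (δ / 3) (η / 3)) (1 / 2) with hr
      have hr0 : 0 < r := by positivity
      have hrδ : r ≤ δ / 3 := (min_le_left _ _).trans (min_le_left _ _)
      have hrη : r ≤ η / 3 := (min_le_left _ _).trans (min_le_right _ _)
      have hr1 : r ≤ 1 / 2 := min_le_right _ _
      have h1 : I = σ⁻¹ * ∫ y in Ω, B.component f t y * divergence (cutoffKernel n m r) (y - x) :=
        (hmain r hr0 (by linarith) t).2
      have hi : IntegrableOn (fun y => B.component f t y *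
          divergence (cutoffKernel n m r) (y - x)) Ω :=
        (((hf.continuousOn t).mul ((continuous_divergence_cutoffKernel hr0).comp
          (continuous_id.sub continuous_const)).continuousOn).integrableOn_compact
          (isCompact_closure_of_isBounded hΩ.isBounded)).mono_set subset_closure
      have h2 := abs_integral_mul_divergence_cutoffKernel_sub_le hd hr0 (by nlinarith)
        (g := B.component f t) (ε := ε) (fun y hy => ⟨hball (by
          rw [Metric.mem_ball, dist_eq_norm]; linarith), (hηε (by
          rw [dist_eq_norm]; linarith)).le⟩) hi
      rw [← hσ] at h2
      have h3 : (∫ y in Ω, B.component f t y * divergence (cutoffKernel n m r) (y - x)) =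
          σ * I := by
        rw [h1, mul_inv_cancel_left₀ hσ0.ne']
      rw [h3, ← mul_sub, abs_mul, abs_of_pos hσ0, mul_comm ε] at h2
      exact le_of_mul_le_mul_left h2 hσ0
    rw [HypercomplexBasis.surfaceIntegral]
    simp only [hcomp]
    exact B.basis.sum_repr (f x)
  · intro x hx
    obtain ⟨δ, hδ, hball⟩ := Metric.isOpen_iff.1 isClosed_closure.isOpen_compl x hx
    have hfar := hsq hδ (half_pos hδ) le_rfl hball
    have hmain := B.integrableOn_and_integral_kernelStar hd hΩ hf (half_pos hδ) fun y hy =>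
        (hfar y (frontier_subset_closure hy)).le
    refine ⟨fun t => (hmain t).1, ?_⟩
    rw [HypercomplexBasis.surfaceIntegral]
    refine Finset.sum_eq_zero fun t _ => ?_
    rw [(hmain t).2, setIntegral_eq_zero_of_forall_eq_zero, mul_zero, zero_smul]
    intro y hy
    rw [divergence_cutoffKernel_of_gt (half_pos hδ) (hfar y (subset_closure hy)), mul_zero]
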